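/- **Setting.** Let $V=\mathbb R^2$ with coordinates $(x,y)$ and canonical flat connection $\nabla$. A contravariant pseudo-Hessian structure on $V$ is a smooth symmetric bivector field $h$ with $(\nabla_{h_\#(\alpha)}h)(\beta,\gamma)=(\nabla_{h_\#(\beta)}h)(\alpha,\gamma)$ for all one-forms $\alpha,\beta,\gamma$, where $\beta(h_\#(\alpha))=h(\alpha,\beta)$. It is quadratic if in the linear coordinates $(x_1,x_2)$ of some basis every $h(dx_i,dx_j)$ is of the form $\sum_{l,k}a_{lk}x_lx_k$. Its divergence is the vector field with components $\mathrm{div}_\nabla(h)^j=\sum_i\partial_{x_i}h(dx_i,dx_j)$. Two such structures are affinely isomorphic if $h'=F_*h$ for some affine automorphism $F$ of $\mathbb R^2$. A matrix below stands for $\big(h(dx_i,dx_j)\big)$, and all parameters are real. **Theorem.** For every quadratic contravariant pseudo-Hessian structure $h$ on $\mathbb R^2$ there is a unique matrix $L^h$ such that $\mathrm{div}_\nabla(h)$ is the linear vector field $v\mapsto L^hv$, and affinely isomorphic structures have similar matrices $L^h$. Moreover: 1. The bivector fields $$h_1=\begin{pmatrix}0&0\\0&ux^2\end{pmatrix},\qquad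 h_2=\begin{pmatrix}\frac{r^2x^2}{c}-2rxy+cy^2&\frac{r^3x^2}{c^2}-\frac{2r^2xy}{c}+ry^2\\ \frac{r^3x^2}{c^2}-\frac{2r^2xy}{c}+ry^2&-\frac{2r^3xy}{c^2}+\frac{r^4x^2}{c^3}+\frac{r^2y^2}{c}\end{pmatrix}\ (c\neq0)$$ are divergence-free quadratic contravariant pseudo-Hessian structures, and every divergence-free one is affinely isomorphic to one of these. Furthermore $h_1(u)$ and $h_1(u')$ are affinely isomorphic if and only if $u$ and $u'$ have the same sign ($+$, $0$ or $-$), and $h_2(r,c)$ is affinely isomorphic to $h_1(c)$; so there are exactly two nonzero classes. 2. The bivector fields $$h_1=\begin{pmatrix}cy^2+xy&0\\0&0\end{pmatrix},\qquad h_2=\begin{pmatrix}\frac12xy+cy^2&\frac{y^2}{4}\\ \frac{y^2}{4}&0\end{pmatrix}$$ are quadratic contravariant pseudo-Hessian structures with $L^h$ similar to $\begin{pmatrix}a&1\\0&a\end{pmatrix}$ with $a=0$, and every structure with $L^h$ similar to $\begin{pmatrix}a&1\\0&a\end{pmatrix}$ for some real $a$ is affinely isomorphic to one of these. No member of the first family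 is affinely isomorphic to a member of the second. 3. The bivector fields $$h_1=\begin{pmatrix}ax^2&0\\0&by^2\end{pmatrix},\quad h_2=\begin{pmatrix}ax^2+by^2&0\\0&0\end{pmatrix},\quad h_3=\begin{pmatrix}ax^2&axy\\axy&ay^2\end{pmatrix},\quad h_4=\begin{pmatrix}\frac{2r^2x^2}{c}-2rxy+cy^2&ry^2\\ry^2&\frac{2r^2y^2}{c}\end{pmatrix}\ (c\ne0),$$ $$h_5=\begin{pmatrix}\left(\frac{2p^2}{u}+\frac q2\right)x^2+\frac{pqxy}{u}+\frac{q^2y^2}{4u}&px^2+qxy-\frac{pqy^2}{2u}\\ px^2+qxy-\frac{pqy^2}{2u}&\left(\frac{2p^2}{u}+\frac q2\right)y^2+ux^2-2pxy\end{pmatrix}\ (u\neq0)$$ are quadratic contravariant pseudo-Hessian structures with $L^h$ diagonalizable over $\mathbb R$, and every structure with $L^h$ diagonalizable over $\mathbb R$ is affinely isomorphic to one of these. The following members are not affinely isomorphic to any member of the other four families: $h_1(a,b)$ with $a,b\ne0$ and $a\neq b$; $h_2(a,b)$ with $a,b\neq0$; $h_3(a)$ with $a\ne0$; $h_5(p,q,u)$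 with $2p^2+qu<0$. For $r\ne0$, $h_4(r,c)$ is affinely isomorphic to $h_1\!\left(\frac{2r^2}{c},\frac{2r^2}{c}\right)$. 4. For $p\neq0$ the bivector field $$h=\begin{pmatrix}-2pxy-ux^2+uy^2&px^2-py^2-2uxy\\px^2-py^2-2uxy&2pxy+ux^2-uy^2\end{pmatrix}$$ is a quadratic contravariant pseudo-Hessian structure whose $L^h$ has non-real eigenvalues, and every structure whose $L^h$ has non-real eigenvalues is affinely isomorphic to one of these. -/

import Mathlib

open scoped ContDiff

noncomputable section

/-- A (rough) field of bilinear forms on the cotangent spaces of a vector space `V`: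
the cotangent space at each point is identified with `Module.Dual ℝ V`.
Symmetry and smoothness are imposed in `IsContravariantPseudoHessian`. -/
abbrev BivectorField (V : Type*) [AddCommGroup V] [Module ℝ V] : Type _ :=
  V → LinearMap.BilinForm ℝ (Module.Dual ℝ V)

namespace BivectorField

section General

variable {V : Type*} [NormedAddCommGroup V] [NormedSpace ℝ V] [FiniteDimensional ℝ V]

/-- The contraction `h_♯ : T*V → TV`, characterized by `β (h_♯ α) = h (α, β)`. -/
def sharp (h : BivectorField V) (x : V) (α : Module.Dual ℝ V) : V :=
  (Module.evalEquiv ℝ V).symm (h x α)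

theorem apply_sharp (h : BivectorField V) (x : V) (α β : Module.Dual ℝ V) :
    β (h.sharp x α) = h x α β := by
  simp [sharp]

/-- The covariant derivative `(∇_v h)(β, γ)` at `x` for the canonical flat connection `∇` of the
vector space `V`. A constant one-form is parallel, so this is the derivative of the function
`y ↦ h_y(β, γ)` in the direction `v`. -/
def covDeriv (h : BivectorField V) (x v : V) (β γ : Module.Dual ℝ V) : ℝ :=
  fderiv ℝ (fun y => h y β γ) x v

/-- `(V, ∇, h)` is a contravariant pseudo-Hessian manifold: `h` is a smooth symmetric bivector field
with `(∇_{h_♯ α} h)(β, γ) = (∇_{h_♯ β} h)(α, γ)`. Both sides are tensorial in `α, β, γ`, so it is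
enough to let these range over the cotangent space at each point. -/
structure IsContravariantPseudoHessian (h : BivectorField V) : Prop where
  smooth : ∀ α β : Module.Dual ℝ V, ContDiff ℝ ∞ (fun x => h x α β)
  symm : ∀ (x : V) (α β : Module.Dual ℝ V), h x α β = h x β α
  codazzi : ∀ (x : V) (α β γ : Module.Dual ℝ V),
    h.covDeriv x (h.sharp x α) β γ = h.covDeriv x (h.sharp x β) α γ

/-- `h` is quadratic: for some basis of `V`, with linear coordinates `(x₁, …, xₙ)`, every
`h(dxᵢ, dxⱼ)` is of the form `∑ aₗₖ xₗ xₖ`. -/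
def IsQuadratic (h : BivectorField V) : Prop :=
  ∃ b : Module.Basis (Fin (Module.finrank ℝ V)) ℝ V, ∀ i j,
    ∃ a : Fin (Module.finrank ℝ V) → Fin (Module.finrank ℝ V) → ℝ, ∀ x : V,
      h x (b.coord i) (b.coord j) = ∑ l, ∑ k, a l k * b.coord l x * b.coord k x

/-- Quadratic contravariant pseudo-Hessian structures on `V`. -/
def IsQuadraticPseudoHessian (h : BivectorField V) : Prop :=
  h.IsContravariantPseudoHessian ∧ h.IsQuadratic

/-- `h'` is the push-forward `F_* h` of `h` under some affine automorphism `F` of `V`, that is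
`h'_{F x}(α, β) = h_x(F^* α, F^* β)`. -/
def AffineIsomorphic (h h' : BivectorField V) : Prop :=
  ∃ F : V ≃ᵃ[ℝ] V, ∀ (x : V) (α β : Module.Dual ℝ V),
    h' (F x) α β =
      h x (α ∘ₗ (F.linear : V →ₗ[ℝ] V)) (β ∘ₗ (F.linear : V →ₗ[ℝ] V))

end General

section Coordinates

variable {n : ℕ}

/-- The coordinate covector `dxᵢ` on `ℝⁿ`. -/
abbrev dx (i : Fin n) : Module.Dual ℝ (Fin n → ℝ) := LinearMap.proj i

/-- The divergence `div_∇ h`, a vector field on `ℝⁿ`: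
`(div_∇ h)(α) = ∑ᵢ (∇_{eᵢ} h)(dxᵢ, α)`, given by its components `α = dxⱼ`. -/
def divergence (h : BivectorField (Fin n → ℝ)) (x : Fin n → ℝ) : Fin n → ℝ :=
  fun j => ∑ i, h.covDeriv x (Pi.single i 1) (dx i) (dx j)

/-- The divergence of `h` is the linear vector field `x ↦ L x`. -/
def HasDivergenceMatrix (h : BivectorField (Fin n → ℝ)) (L : Matrix (Fin n) (Fin n) ℝ) : Prop :=
  ∀ x, h.divergence x = L.mulVec x

/-- The bivector field on `ℝⁿ` with `h(dxᵢ, dxⱼ) = mᵢⱼ`. -/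
def ofMatrix (m : (Fin n → ℝ) → Matrix (Fin n) (Fin n) ℝ) : BivectorField (Fin n → ℝ) :=
  fun x => Matrix.toBilin (Pi.basisFun ℝ (Fin n)).dualBasis (m x)

theorem ofMatrix_dx (m : (Fin n → ℝ) → Matrix (Fin n) (Fin n) ℝ) (x : Fin n → ℝ) (i j : Fin n) :
    ofMatrix m x (dx i) (dx j) = m x i j := by
  have key : ∀ k : Fin n, dx k = (Pi.basisFun ℝ (Fin n)).dualBasis k := by
    intro k
    ext v
    simp
  rw [key, key, ofMatrix, ← LinearMap.BilinForm.toMatrix_apply, LinearMap.BilinForm.toMatrix_toBilin]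

end Coordinates

/-! ### Types of linear divergence on the plane -/

/-- The divergence vanishes identically. -/
def IsDivergenceFree (h : BivectorField (Fin 2 → ℝ)) : Prop := ∀ x, h.divergence x = 0

/-- The divergence is linear and similar to the Jordan block with eigenvalue `a`. -/
def HasJordanDivergence (h : BivectorField (Fin 2 → ℝ)) (a : ℝ) : Prop :=
  ∃ L : Matrix (Fin 2) (Fin 2) ℝ, h.HasDivergenceMatrix L ∧ IsConj L !![a, 1; 0, a]

/-- The divergence is linear and diagonalizable over `ℝ`. -/
def HasDiagonalizableDivergence (h : BivectorField (Fin 2 → ℝ)) : Prop :=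
  ∃ L : Matrix (Fin 2) (Fin 2) ℝ, h.HasDivergenceMatrix L ∧
    ∃ d : Fin 2 → ℝ, IsConj L (Matrix.diagonal d)

/-- The divergence is linear with non-real eigenvalues. For a real `2 × 2` matrix, if one complex
eigenvalue is non-real then both are. -/
def HasNonRealDivergence (h : BivectorField (Fin 2 → ℝ)) : Prop :=
  ∃ L : Matrix (Fin 2) (Fin 2) ℝ, h.HasDivergenceMatrix L ∧
    ∃ z ∈ spectrum ℂ (L.map (algebraMap ℝ ℂ)), z.im ≠ 0

/-! ### The normal forms on the plane, in coordinates `x = v 0`, `y = v 1` -/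

/-- The bivector field on the plane with matrix `m x y` at the point `(x, y)`. -/
def ofPlaneMatrix (m : ℝ → ℝ → Matrix (Fin 2) (Fin 2) ℝ) : BivectorField (Fin 2 → ℝ) :=
  ofMatrix fun v => m (v 0) (v 1)

def free₁ (u : ℝ) : BivectorField (Fin 2 → ℝ) :=
  ofPlaneMatrix fun x _ => !![0, 0; 0, u * x ^ 2]

def free₂ (r c : ℝ) : BivectorField (Fin 2 → ℝ) :=
  ofPlaneMatrix fun x y =>
    !![r ^ 2 * x ^ 2 / c - 2 * r * x * y + c * y ^ 2,
        r ^ 3 * x ^ 2 / c ^ 2 - 2 * r ^ 2 * x * y / c + r * y ^ 2;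
       r ^ 3 * x ^ 2 / c ^ 2 - 2 * r ^ 2 * x * y / c + r * y ^ 2,
        -(2 * r ^ 3 * x * y / c ^ 2) + r ^ 4 * x ^ 2 / c ^ 3 + r ^ 2 * y ^ 2 / c]

def jordan₁ (c : ℝ) : BivectorField (Fin 2 → ℝ) :=
  ofPlaneMatrix fun x y => !![c * y ^ 2 + x * y, 0; 0, 0]

def jordan₂ (c : ℝ) : BivectorField (Fin 2 → ℝ) :=
  ofPlaneMatrix fun x y => !![1 / 2 * x * y + c * y ^ 2, y ^ 2 / 4; y ^ 2 / 4, 0]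

def diag₁ (a b : ℝ) : BivectorField (Fin 2 → ℝ) :=
  ofPlaneMatrix fun x y => !![a * x ^ 2, 0; 0, b * y ^ 2]

def diag₂ (a b : ℝ) : BivectorField (Fin 2 → ℝ) :=
  ofPlaneMatrix fun x y => !![a * x ^ 2 + b * y ^ 2, 0; 0, 0]

def diag₃ (a : ℝ) : BivectorField (Fin 2 → ℝ) :=
  ofPlaneMatrix fun x y => !![a * x ^ 2, a * x * y; a * x * y, a * y ^ 2]

def diag₄ (r c : ℝ) : BivectorField (Fin 2 → ℝ) :=
  ofPlaneMatrix fun x y =>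
    !![2 * r ^ 2 * x ^ 2 / c - 2 * r * x * y + c * y ^ 2, r * y ^ 2;
       r * y ^ 2, 2 * r ^ 2 * y ^ 2 / c]

def diag₅ (p q u : ℝ) : BivectorField (Fin 2 → ℝ) :=
  ofPlaneMatrix fun x y =>
    !![(2 * p ^ 2 / u + q / 2) * x ^ 2 + p * q * x * y / u + q ^ 2 * y ^ 2 / (4 * u),
        p * x ^ 2 + q * x * y - p * q * y ^ 2 / (2 * u);
       p * x ^ 2 + q * x * y - p * q * y ^ 2 / (2 * u),
        (2 * p ^ 2 / u + q / 2) * y ^ 2 + u * x ^ 2 - 2 * p * x * y]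

def nonReal (p u : ℝ) : BivectorField (Fin 2 → ℝ) :=
  ofPlaneMatrix fun x y =>
    !![-(2 * p * x * y) - u * x ^ 2 + u * y ^ 2, p * x ^ 2 - p * y ^ 2 - 2 * u * x * y;
       p * x ^ 2 - p * y ^ 2 - 2 * u * x * y, 2 * p * x * y + u * x ^ 2 - u * y ^ 2]

end BivectorField

end

open BivectorField

/-! A quadratic structure on the plane is given by nine coefficients: three binary quadratic forms
`h₀₀`, `h₀₁`, `h₁₁`. The Codazzi condition is antisymmetric in the first two covectors, so only the
pair `dx 0, dx 1` matters. With two choices for the third covector it becomes the vanishing of two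
binary cubics, that is, eight quadratic equations in the coefficients
(`isContravariantPseudoHessian_planeQuad_iff`).

The divergence matrix `L` is linear in the coefficients, and push-forward by `P` turns `L` into `P L
P⁻¹`. So `L` may be put in normal form, which eliminates four coefficients. Three combinations of
the Codazzi equations (`f₁ + g₂`, `f₂ + 3 g₃`, `g₁ + 3 f₀` in the proofs) say that `L h` is
symmetric: `(L₀₀ - L₁₁) h₀₁ + L₀₁ h₁₁ - L₁₀ h₀₀ = 0`. This forces `h₁₁ = 0` for a Jordan block, `h₀₁
= 0` for distinct real eigenvalues and `h₀₀ = -h₁₁` for a rotation-scaling matrix. For scalar `L` it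
is void, and the individual equations are solved according to which coefficients vanish. The
surviving solutions are the listed families, up to exchange of coordinates.

Affine isomorphisms of quadratic fields may be taken linear, since a quadratic form equals any
quadratic form that is a translate of it. Non-isomorphism then follows from two invariants: the
similarity class of `L`, and the determinant of the matrix of `h`, which changes by a linear
substitution and the factor `det P ^ 2`. Only `diag₂` against `diag₁` needs a direct comparison of
entries. -/

noncomputable section

namespace BivectorField

/-! ### Push-forward by linear automorphisms. -/

section Pushforward

variable {V : Type*} [NormedAddCommGroup V] [NormedSpace ℝ V]

/-- The push-forward of a bivector field under a linear automorphism. -/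
def pushforward (F : V ≃ₗ[ℝ] V) (h : BivectorField V) : BivectorField V := fun x =>
  (h (F.symm x)).compl₁₂ (F : V →ₗ[ℝ] V).dualMap (F : V →ₗ[ℝ] V).dualMap

theorem pushforward_apply (F : V ≃ₗ[ℝ] V) (h : BivectorField V) (x : V) (α β : Module.Dual ℝ V) :
    pushforward F h x α β = h (F.symm x) (α ∘ₗ (F : V →ₗ[ℝ] V)) (β ∘ₗ (F : V →ₗ[ℝ] V)) := rfl

theorem affineIsomorphic_pushforward (F : V ≃ₗ[ℝ] V) (h : BivectorField V) :
    h.AffineIsomorphic (pushforward F h) := by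
  refine ⟨F.toAffineEquiv, fun x α β => ?_⟩
  have hx : F.symm (F.toAffineEquiv x) = x := F.symm_apply_apply x
  rw [pushforward_apply, hx]
  rfl

theorem AffineIsomorphic.trans {h₁ h₂ h₃ : BivectorField V} (h₁₂ : h₁.AffineIsomorphic h₂)
    (h₂₃ : h₂.AffineIsomorphic h₃) : h₁.AffineIsomorphic h₃ := by
  obtain ⟨F, hF⟩ := h₁₂
  obtain ⟨G, hG⟩ := h₂₃
  refine ⟨F.trans G, fun x α β => ?_⟩
  have hx : (F.trans G) x = G (F x) := rfl
  rw [hx, hG, hF]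
  rfl

theorem AffineIsomorphic.refl (h : BivectorField V) : h.AffineIsomorphic h :=
  ⟨AffineEquiv.refl ℝ V, fun _ _ _ => rfl⟩

theorem IsQuadratic.pushforward {h : BivectorField V} (hh : h.IsQuadratic) (F : V ≃ₗ[ℝ] V) :
    (pushforward F h).IsQuadratic := by
  obtain ⟨b, hb⟩ := hh
  refine ⟨b.map F, fun i j => ?_⟩
  obtain ⟨a, ha⟩ := hb i j
  refine ⟨a, fun x => ?_⟩
  have hc : ∀ i, (b.map F).coord i ∘ₗ (F : V →ₗ[ℝ] V) = b.coord i := by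
    intro i
    ext v
    simp
  rw [pushforward_apply, hc, hc, ha]
  simp

variable [FiniteDimensional ℝ V]

theorem sharp_pushforward (F : V ≃ₗ[ℝ] V) (h : BivectorField V) (x : V) (α : Module.Dual ℝ V) :
    (pushforward F h).sharp x α = F (h.sharp (F.symm x) (α ∘ₗ (F : V →ₗ[ℝ] V))) := by
  refine (Module.forall_dual_apply_eq_zero_iff ℝ _).1 ?_ |> sub_eq_zero.1
  intro β
  have key := apply_sharp h (F.symm x) (α ∘ₗ (F : V →ₗ[ℝ] V)) (β ∘ₗ (F : V →ₗ[ℝ] V))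
  rw [map_sub, apply_sharp, pushforward_apply, ← key]
  simp

theorem covDeriv_pushforward (F : V ≃ₗ[ℝ] V) (h : BivectorField V) (x v : V)
    (β γ : Module.Dual ℝ V) :
    (pushforward F h).covDeriv x v β γ =
      h.covDeriv (F.symm x) (F.symm v) (β ∘ₗ (F : V →ₗ[ℝ] V)) (γ ∘ₗ (F : V →ₗ[ℝ] V)) := by
  have key := F.symm.toContinuousLinearEquiv.comp_right_fderiv
    (f := fun y => h y (β ∘ₗ (F : V →ₗ[ℝ] V)) (γ ∘ₗ (F : V →ₗ[ℝ] V))) (x := x)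
  exact DFunLike.congr_fun key v

theorem IsContravariantPseudoHessian.pushforward {h : BivectorField V}
    (hh : h.IsContravariantPseudoHessian) (F : V ≃ₗ[ℝ] V) :
    (pushforward F h).IsContravariantPseudoHessian where
  smooth α β := (hh.smooth _ _).comp F.symm.toContinuousLinearEquiv.contDiff
  symm x α β := hh.symm _ _ _
  codazzi x α β γ := by
    simp only [covDeriv_pushforward, sharp_pushforward, LinearEquiv.symm_apply_apply]
    exact hh.codazzi _ _ _ _

theorem IsQuadraticPseudoHessian.pushforward {h : BivectorField V}
    (hh : h.IsQuadraticPseudoHessian) (F : V ≃ₗ[ℝ] V) :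
    (pushforward F h).IsQuadraticPseudoHessian :=
  ⟨hh.1.pushforward F, hh.2.pushforward F⟩

/-- Smoothness enters only to differentiate the sum term by term; without it `fderiv` need not be
additive. -/
theorem covDeriv_sum_left {ι : Type*} (s : Finset ι) {h : BivectorField V}
    (hh : h.IsContravariantPseudoHessian) (x v : V) (c : ι → ℝ) (β : ι → Module.Dual ℝ V)
    (γ : Module.Dual ℝ V) :
    h.covDeriv x v (∑ i ∈ s, c i • β i) γ = ∑ i ∈ s, c i * h.covDeriv x v (β i) γ := by
  have hd : ∀ i, DifferentiableAt ℝ (fun y => h y (β i) γ) x := fun i =>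
    ((hh.smooth (β i) γ).differentiable (by simp)).differentiableAt
  have hf : (fun y => h y (∑ i ∈ s, c i • β i) γ) = fun y => ∑ i ∈ s, c i * h y (β i) γ := by
    funext y
    simp
  rw [covDeriv, hf, fderiv_fun_sum fun i _ => (hd i).const_mul _]
  simp only [FunLike.coe_sum, Finset.sum_apply, covDeriv]
  refine Finset.sum_congr rfl fun i _ => ?_
  rw [fderiv_const_mul (hd i)]
  rfl

theorem covDeriv_sum_right {ι : Type*} (s : Finset ι) {h : BivectorField V}
    (hh : h.IsContravariantPseudoHessian) (x v : V) (c : ι → ℝ) (β : Module.Dual ℝ V)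
    (γ : ι → Module.Dual ℝ V) :
    h.covDeriv x v β (∑ i ∈ s, c i • γ i) = ∑ i ∈ s, c i * h.covDeriv x v β (γ i) := by
  have hs : ∀ β γ : Module.Dual ℝ V, h.covDeriv x v β γ = h.covDeriv x v γ β := by
    intro β γ
    simp only [covDeriv, hh.symm _ β γ]
  rw [hs, covDeriv_sum_left s hh]
  simp only [hs β]

end Pushforward

/-! ### Divergence in coordinates and its behaviour under push-forward. -/

section Coordinates

variable {n : ℕ}

theorem dual_eq_sum_dx (α : Module.Dual ℝ (Fin n → ℝ)) :
    α = ∑ i, α (Pi.single i 1) • dx i := by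
  ext j
  simp [Pi.single_apply]

/-- The linear automorphism of `ℝⁿ` given by an invertible matrix. -/
def unitEquiv (P : (Matrix (Fin n) (Fin n) ℝ)ˣ) : (Fin n → ℝ) ≃ₗ[ℝ] (Fin n → ℝ) :=
  LinearEquiv.ofLinearMap (Matrix.toLin' P.val) (Matrix.toLin' P.inv)
    (by rw [← Matrix.toLin'_mul, P.val_inv, Matrix.toLin'_one])
    (by rw [← Matrix.toLin'_mul, P.inv_val, Matrix.toLin'_one])

theorem unitEquiv_apply (P : (Matrix (Fin n) (Fin n) ℝ)ˣ) (x : Fin n → ℝ) :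
    unitEquiv P x = P.val.mulVec x := rfl

theorem unitEquiv_symm_apply (P : (Matrix (Fin n) (Fin n) ℝ)ˣ) (x : Fin n → ℝ) :
    (unitEquiv P).symm x = P.inv.mulVec x := rfl

theorem exists_unitEquiv (F : (Fin n → ℝ) ≃ₗ[ℝ] (Fin n → ℝ)) : ∃ P, unitEquiv P = F := by
  refine ⟨⟨LinearMap.toMatrix' (F : (Fin n → ℝ) →ₗ[ℝ] _),
    LinearMap.toMatrix' (F.symm : (Fin n → ℝ) →ₗ[ℝ] _), ?_, ?_⟩, ?_⟩
  · rw [← LinearMap.toMatrix'_comp]; simp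
  · rw [← LinearMap.toMatrix'_comp]; simp
  · ext x : 1
    rw [unitEquiv_apply, ← Matrix.toLin'_apply, Matrix.toLin'_toMatrix']
    rfl

theorem dx_comp_unitEquiv (P : (Matrix (Fin n) (Fin n) ℝ)ˣ) (i : Fin n) :
    (dx i : Module.Dual ℝ (Fin n → ℝ)) ∘ₗ (unitEquiv P : (Fin n → ℝ) →ₗ[ℝ] (Fin n → ℝ)) =
      ∑ j, P.val i j • dx j := by
  ext j
  simp [unitEquiv_apply, Pi.single_apply]

/-- The divergence is a contraction of the tensor `∇h`, hence natural: the direction index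
transforms by `P⁻¹`, the contracted covector index by `P`, and the two cancel. -/
theorem divergence_pushforward {h : BivectorField (Fin n → ℝ)}
    (hh : h.IsContravariantPseudoHessian) (P : (Matrix (Fin n) (Fin n) ℝ)ˣ) (x : Fin n → ℝ) :
    (pushforward (unitEquiv P) h).divergence x = P.val.mulVec (h.divergence (P.inv.mulVec x)) := by
  funext j
  have hsingle : ∀ i : Fin n, (unitEquiv P).symm (Pi.single i 1) =
      ∑ k, P.inv k i • (Pi.single k 1 : Fin n → ℝ) := by
    intro i
    rw [unitEquiv_symm_apply]
    ext k
    simp [Finset.sum_apply, Pi.single_apply]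
  have hlin : ∀ (y : Fin n → ℝ) (i : Fin n) (β γ : Module.Dual ℝ (Fin n → ℝ)),
      h.covDeriv y (∑ k, P.inv k i • (Pi.single k 1 : Fin n → ℝ)) β γ =
        ∑ k, P.inv k i * h.covDeriv y (Pi.single k 1) β γ := by
    intro y i β γ
    simp [covDeriv]
  have hdelta : ∀ k l : Fin n, ∑ i, P.inv k i * P.val i l = if k = l then 1 else 0 := by
    intro k l
    rw [← Matrix.mul_apply, P.inv_val, Matrix.one_apply]
  simp only [divergence, covDeriv_pushforward, dx_comp_unitEquiv, hsingle, hlin,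
    covDeriv_sum_left _ hh, covDeriv_sum_right _ hh, Matrix.mulVec, dotProduct]
  rw [← unitEquiv_symm_apply]
  set D : Fin n → Fin n → Fin n → ℝ :=
    fun k l m => h.covDeriv ((unitEquiv P).symm x) (Pi.single k 1) (dx l) (dx m) with hD
  change ∑ i, ∑ k, P.inv k i * ∑ l, P.val i l * ∑ m, P.val j m * D k l m =
    ∑ m, P.val j m * ∑ k, D k k m
  have hE : ∀ E : Fin n → Fin n → ℝ,
      ∑ i, ∑ k, P.inv k i * ∑ l, P.val i l * E k l = ∑ k, E k k := by
    intro E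
    calc ∑ i, ∑ k, P.inv k i * ∑ l, P.val i l * E k l
        = ∑ k, ∑ l, (∑ i, P.inv k i * P.val i l) * E k l := by
          rw [Finset.sum_comm]
          refine Finset.sum_congr rfl fun k _ => ?_
          simp only [Finset.mul_sum, Finset.sum_mul]
          rw [Finset.sum_comm]
          simp only [mul_assoc]
      _ = ∑ k, E k k := by simp only [hdelta]; simp
  rw [hE fun k l => ∑ m, P.val j m * D k l m, Finset.sum_comm]
  simp only [Finset.mul_sum]

theorem HasDivergenceMatrix.pushforward {h : BivectorField (Fin n → ℝ)}
    {L : Matrix (Fin n) (Fin n) ℝ} (hL : h.HasDivergenceMatrix L)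
    (hh : h.IsContravariantPseudoHessian) (P : (Matrix (Fin n) (Fin n) ℝ)ˣ) :
    (pushforward (unitEquiv P) h).HasDivergenceMatrix (P.val * L * P.inv) := by
  intro x
  rw [divergence_pushforward hh, hL, Matrix.mulVec_mulVec, Matrix.mulVec_mulVec, mul_assoc]

theorem HasDivergenceMatrix.unique {h : BivectorField (Fin n → ℝ)}
    {L L' : Matrix (Fin n) (Fin n) ℝ} (hL : h.HasDivergenceMatrix L)
    (hL' : h.HasDivergenceMatrix L') : L = L' := by
  refine Matrix.mulVec_injective ?_
  funext x
  rw [← hL x, hL' x]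

/-- A structure whose divergence matrix is similar to `N` can be moved to one with divergence
matrix `N`. -/
theorem exists_affineIsomorphic_of_isConj {h : BivectorField (Fin n → ℝ)}
    (hh : h.IsQuadraticPseudoHessian) {L N : Matrix (Fin n) (Fin n) ℝ}
    (hL : h.HasDivergenceMatrix L) (hN : IsConj L N) :
    ∃ h' : BivectorField (Fin n → ℝ), h'.IsQuadraticPseudoHessian ∧ h'.HasDivergenceMatrix N ∧
      h.AffineIsomorphic h' := by
  obtain ⟨P, hP⟩ := hN
  refine ⟨pushforward (unitEquiv P) h, hh.pushforward _, ?_, affineIsomorphic_pushforward _ _⟩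
  have key : P.val * L * P.inv = N := by
    rw [hP.eq, mul_assoc, P.val_inv, mul_one]
  exact key ▸ hL.pushforward hh.1 P

end Coordinates

/-! ### Quadratic fields on the plane and the Codazzi equations in coefficients. -/

section Plane

/-- The binary quadratic form with the given coefficients. -/
def binaryForm (p q r : ℝ) (v : Fin 2 → ℝ) : ℝ := p * v 0 ^ 2 + q * v 0 * v 1 + r * v 1 ^ 2

theorem hasFDerivAt_binaryForm (p q r : ℝ) (x : Fin 2 → ℝ) :
    HasFDerivAt (binaryForm p q r)
      ((2 * p * x 0 + q * x 1) • ContinuousLinearMap.proj (R := ℝ) (φ := fun _ : Fin 2 => ℝ) 0 +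
        (q * x 0 + 2 * r * x 1) • ContinuousLinearMap.proj (R := ℝ) (φ := fun _ : Fin 2 => ℝ) 1)
      x := by
  have h0 : HasFDerivAt (fun v : Fin 2 → ℝ => v 0)
      (ContinuousLinearMap.proj (R := ℝ) (φ := fun _ : Fin 2 => ℝ) 0) x := hasFDerivAt_apply 0 x
  have h1 : HasFDerivAt (fun v : Fin 2 → ℝ => v 1)
      (ContinuousLinearMap.proj (R := ℝ) (φ := fun _ : Fin 2 => ℝ) 1) x := hasFDerivAt_apply 1 x
  refine ((((h0.pow 2).const_mul p).add ((h0.const_mul q).mul h1)).add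
    ((h1.pow 2).const_mul r)).congr_fderiv ?_
  ext v
  simp
  ring

theorem contDiff_binaryForm (p q r : ℝ) : ContDiff ℝ ∞ (binaryForm p q r) := by
  unfold binaryForm
  fun_prop

/-- The bivector field on the plane whose entries are the given binary quadratic forms. -/
def planeQuad (a₀ a₁ a₂ b₀ b₁ b₂ c₀ c₁ c₂ : ℝ) : BivectorField (Fin 2 → ℝ) :=
  ofPlaneMatrix fun x y =>
    !![a₀ * x ^ 2 + a₁ * x * y + a₂ * y ^ 2, b₀ * x ^ 2 + b₁ * x * y + b₂ * y ^ 2;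
       b₀ * x ^ 2 + b₁ * x * y + b₂ * y ^ 2, c₀ * x ^ 2 + c₁ * x * y + c₂ * y ^ 2]

/-- The matrix of a bivector field on the plane. -/
def gram (h : BivectorField (Fin 2 → ℝ)) (x : Fin 2 → ℝ) : Matrix (Fin 2) (Fin 2) ℝ :=
  Matrix.of fun i j => h x (dx i) (dx j)

theorem gram_ofPlaneMatrix (m : ℝ → ℝ → Matrix (Fin 2) (Fin 2) ℝ) (x : Fin 2 → ℝ) :
    gram (ofPlaneMatrix m) x = m (x 0) (x 1) := by
  ext i j
  exact ofMatrix_dx (fun v => m (v 0) (v 1)) x i j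

theorem apply_eq_gram (h : BivectorField (Fin 2 → ℝ)) (x : Fin 2 → ℝ)
    (α β : Module.Dual ℝ (Fin 2 → ℝ)) :
    h x α β =
      α (Pi.single 0 1) * β (Pi.single 0 1) * gram h x 0 0 +
      α (Pi.single 0 1) * β (Pi.single 1 1) * gram h x 0 1 +
      α (Pi.single 1 1) * β (Pi.single 0 1) * gram h x 1 0 +
      α (Pi.single 1 1) * β (Pi.single 1 1) * gram h x 1 1 := by
  conv_lhs => rw [dual_eq_sum_dx α, dual_eq_sum_dx β]
  simp only [Fin.sum_univ_two, map_add, map_smul, LinearMap.add_apply, LinearMap.smul_apply,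
    smul_eq_mul, gram, Matrix.of_apply]
  ring

theorem ext_gram {h h' : BivectorField (Fin 2 → ℝ)} (hg : ∀ x, gram h x = gram h' x) :
    h = h' := by
  funext x
  refine LinearMap.ext fun α => LinearMap.ext fun β => ?_
  rw [apply_eq_gram, apply_eq_gram, hg]

variable {a₀ a₁ a₂ b₀ b₁ b₂ c₀ c₁ c₂ : ℝ}

theorem planeQuad_apply (x : Fin 2 → ℝ) (α β : Module.Dual ℝ (Fin 2 → ℝ)) :
    planeQuad a₀ a₁ a₂ b₀ b₁ b₂ c₀ c₁ c₂ x α β =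
      α (Pi.single 0 1) * β (Pi.single 0 1) * binaryForm a₀ a₁ a₂ x +
      (α (Pi.single 0 1) * β (Pi.single 1 1) + α (Pi.single 1 1) * β (Pi.single 0 1)) *
        binaryForm b₀ b₁ b₂ x +
      α (Pi.single 1 1) * β (Pi.single 1 1) * binaryForm c₀ c₁ c₂ x := by
  rw [apply_eq_gram, planeQuad, gram_ofPlaneMatrix]
  simp [binaryForm]
  ring

theorem contDiff_planeQuad (α β : Module.Dual ℝ (Fin 2 → ℝ)) :
    ContDiff ℝ ∞ fun x => planeQuad a₀ a₁ a₂ b₀ b₁ b₂ c₀ c₁ c₂ x α β := by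
  simp only [planeQuad_apply]
  exact ((contDiff_const.mul (contDiff_binaryForm _ _ _)).add
    (contDiff_const.mul (contDiff_binaryForm _ _ _))).add
    (contDiff_const.mul (contDiff_binaryForm _ _ _))

theorem covDeriv_planeQuad (x v : Fin 2 → ℝ) (α β : Module.Dual ℝ (Fin 2 → ℝ)) :
    (planeQuad a₀ a₁ a₂ b₀ b₁ b₂ c₀ c₁ c₂).covDeriv x v α β =
      α (Pi.single 0 1) * β (Pi.single 0 1) *
        ((2 * a₀ * x 0 + a₁ * x 1) * v 0 + (a₁ * x 0 + 2 * a₂ * x 1) * v 1) +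
      (α (Pi.single 0 1) * β (Pi.single 1 1) + α (Pi.single 1 1) * β (Pi.single 0 1)) *
        ((2 * b₀ * x 0 + b₁ * x 1) * v 0 + (b₁ * x 0 + 2 * b₂ * x 1) * v 1) +
      α (Pi.single 1 1) * β (Pi.single 1 1) *
        ((2 * c₀ * x 0 + c₁ * x 1) * v 0 + (c₁ * x 0 + 2 * c₂ * x 1) * v 1) := by
  have hA := (hasFDerivAt_binaryForm a₀ a₁ a₂ x).const_mul
    (α (Pi.single 0 1) * β (Pi.single 0 1))
  have hB := (hasFDerivAt_binaryForm b₀ b₁ b₂ x).const_mul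
    (α (Pi.single 0 1) * β (Pi.single 1 1) + α (Pi.single 1 1) * β (Pi.single 0 1))
  have hC := (hasFDerivAt_binaryForm c₀ c₁ c₂ x).const_mul
    (α (Pi.single 1 1) * β (Pi.single 1 1))
  have key := ((hA.add hB).add hC).fderiv
  simp only [covDeriv, planeQuad_apply]
  refine (DFunLike.congr_fun key v).trans ?_
  simp
  ring

theorem sharp_planeQuad (x : Fin 2 → ℝ) (α : Module.Dual ℝ (Fin 2 → ℝ)) :
    (planeQuad a₀ a₁ a₂ b₀ b₁ b₂ c₀ c₁ c₂).sharp x α =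
      ![α (Pi.single 0 1) * binaryForm a₀ a₁ a₂ x + α (Pi.single 1 1) * binaryForm b₀ b₁ b₂ x,
        α (Pi.single 0 1) * binaryForm b₀ b₁ b₂ x + α (Pi.single 1 1) * binaryForm c₀ c₁ c₂ x] := by
  have key := fun i : Fin 2 =>
    apply_sharp (planeQuad a₀ a₁ a₂ b₀ b₁ b₂ c₀ c₁ c₂) x α (dx i)
  funext i
  refine (key i).trans ?_
  rw [planeQuad_apply]
  fin_cases i <;> simp

theorem hasDivergenceMatrix_planeQuad :
    (planeQuad a₀ a₁ a₂ b₀ b₁ b₂ c₀ c₁ c₂).HasDivergenceMatrix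
      !![2 * a₀ + b₁, a₁ + 2 * b₂; 2 * b₀ + c₁, b₁ + 2 * c₂] := by
  intro x
  funext j
  simp only [divergence, Fin.sum_univ_two, covDeriv_planeQuad]
  fin_cases j <;> simp [Matrix.mulVec, dotProduct, Fin.sum_univ_two] <;> ring

/-- The Codazzi equation for `planeQuad`, in terms of the coefficients. -/
structure CodazziEqs (a₀ a₁ a₂ b₀ b₁ b₂ c₀ c₁ c₂ : ℝ) : Prop where
  fst₀ : a₀ * (2 * b₀) + b₀ * b₁ - b₀ * (2 * a₀) - c₀ * a₁ = 0
  fst₁ : a₀ * b₁ + a₁ * (2 * b₀) + b₀ * (2 * b₂) + b₁ * b₁ - b₀ * a₁ - b₁ * (2 * a₀) -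
    c₀ * (2 * a₂) - c₁ * a₁ = 0
  fst₂ : a₁ * b₁ + a₂ * (2 * b₀) + b₁ * (2 * b₂) + b₂ * b₁ - b₁ * a₁ - b₂ * (2 * a₀) -
    c₁ * (2 * a₂) - c₂ * a₁ = 0
  fst₃ : a₂ * b₁ + b₂ * (2 * b₂) - b₂ * a₁ - c₂ * (2 * a₂) = 0
  snd₀ : a₀ * (2 * c₀) + b₀ * c₁ - b₀ * (2 * b₀) - c₀ * b₁ = 0
  snd₁ : a₀ * c₁ + a₁ * (2 * c₀) + b₀ * (2 * c₂) + b₁ * c₁ - b₀ * b₁ - b₁ * (2 * b₀) -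
    c₀ * (2 * b₂) - c₁ * b₁ = 0
  snd₂ : a₁ * c₁ + a₂ * (2 * c₀) + b₁ * (2 * c₂) + b₂ * c₁ - b₁ * b₁ - b₂ * (2 * b₀) -
    c₁ * (2 * b₂) - c₂ * b₁ = 0
  snd₃ : a₂ * c₁ + b₂ * (2 * c₂) - b₂ * b₁ - c₂ * (2 * b₂) = 0

/-- A binary cubic vanishing on four pairwise non-proportional vectors is zero. -/
theorem cubic_coeff_eq_zero {k₀ k₁ k₂ k₃ : ℝ}
    (h : ∀ x y : ℝ, k₀ * x ^ 3 + k₁ * x ^ 2 * y + k₂ * x * y ^ 2 + k₃ * y ^ 3 = 0) :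
    k₀ = 0 ∧ k₁ = 0 ∧ k₂ = 0 ∧ k₃ = 0 := by
  have h1 := h 1 0
  have h2 := h 0 1
  have h3 := h 1 1
  have h4 := h 1 (-1)
  norm_num at h1 h2 h3 h4
  refine ⟨h1, ?_, ?_, h2⟩ <;> linarith

/-- In `CodazziEqs` the prefixes `fst` and `snd` stand for third covector `dx 0` and `dx 1`; the
index is the power of `y` in the cubic whose coefficient it is. -/
theorem isContravariantPseudoHessian_planeQuad_iff :
    (planeQuad a₀ a₁ a₂ b₀ b₁ b₂ c₀ c₁ c₂).IsContravariantPseudoHessian ↔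
      CodazziEqs a₀ a₁ a₂ b₀ b₁ b₂ c₀ c₁ c₂ := by
  constructor
  · intro h
    have key : ∀ (i : Fin 2) (x y : ℝ), _ := fun i x y => h.codazzi ![x, y] (dx 0) (dx 1) (dx i)
    simp only [covDeriv_planeQuad, sharp_planeQuad] at key
    have k0 := key 0
    have k1 := key 1
    simp [binaryForm] at k0 k1
    obtain ⟨e0, e1, e2, e3⟩ := cubic_coeff_eq_zero (k₀ := a₀ * (2 * b₀) + b₀ * b₁ - b₀ * (2 * a₀) - c₀ * a₁)
      (k₁ := a₀ * b₁ + a₁ * (2 * b₀) + b₀ * (2 * b₂) + b₁ * b₁ - b₀ * a₁ - b₁ * (2 * a₀) -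
        c₀ * (2 * a₂) - c₁ * a₁)
      (k₂ := a₁ * b₁ + a₂ * (2 * b₀) + b₁ * (2 * b₂) + b₂ * b₁ - b₁ * a₁ - b₂ * (2 * a₀) -
        c₁ * (2 * a₂) - c₂ * a₁)
      (k₃ := a₂ * b₁ + b₂ * (2 * b₂) - b₂ * a₁ - c₂ * (2 * a₂))
      (fun x y => by linear_combination k0 x y)
    obtain ⟨f0, f1, f2, f3⟩ := cubic_coeff_eq_zero (k₀ := a₀ * (2 * c₀) + b₀ * c₁ - b₀ * (2 * b₀) - c₀ * b₁)
      (k₁ := a₀ * c₁ + a₁ * (2 * c₀) + b₀ * (2 * c₂) + b₁ * c₁ - b₀ * b₁ - b₁ * (2 * b₀) -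
        c₀ * (2 * b₂) - c₁ * b₁)
      (k₂ := a₁ * c₁ + a₂ * (2 * c₀) + b₁ * (2 * c₂) + b₂ * c₁ - b₁ * b₁ - b₂ * (2 * b₀) -
        c₁ * (2 * b₂) - c₂ * b₁)
      (k₃ := a₂ * c₁ + b₂ * (2 * c₂) - b₂ * b₁ - c₂ * (2 * b₂))
      (fun x y => by linear_combination k1 x y)
    exact ⟨e0, e1, e2, e3, f0, f1, f2, f3⟩
  · rintro ⟨e0, e1, e2, e3, f0, f1, f2, f3⟩
    refine ⟨contDiff_planeQuad, fun x α β => ?_, fun x α β γ => ?_⟩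
    · simp only [planeQuad_apply]
      ring
    · simp only [covDeriv_planeQuad, sharp_planeQuad, binaryForm, Matrix.cons_val_zero,
        Matrix.cons_val_one]
      generalize α (Pi.single 0 1) = α0
      generalize α (Pi.single 1 1) = α1
      generalize β (Pi.single 0 1) = β0
      generalize β (Pi.single 1 1) = β1
      generalize γ (Pi.single 0 1) = γ0
      generalize γ (Pi.single 1 1) = γ1
      -- The Codazzi defect is alternating in `α, β`, so it is their `2 × 2` determinant times its
      -- value on `dx 0, dx 1`.
      linear_combination (α0 * β1 - α1 * β0) *
        (γ0 * (e0 * x 0 ^ 3 + e1 * x 0 ^ 2 * x 1 + e2 * x 0 * x 1 ^ 2 + e3 * x 1 ^ 3) +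
         γ1 * (f0 * x 0 ^ 3 + f1 * x 0 ^ 2 * x 1 + f2 * x 0 * x 1 ^ 2 + f3 * x 1 ^ 3))

theorem isQuadratic_planeQuad : (planeQuad a₀ a₁ a₂ b₀ b₁ b₂ c₀ c₁ c₂).IsQuadratic := by
  have hn : Module.finrank ℝ (Fin 2 → ℝ) = 2 := by simp
  let e : Fin 2 ≃ Fin (Module.finrank ℝ (Fin 2 → ℝ)) := finCongr hn.symm
  refine ⟨(Pi.basisFun ℝ (Fin 2)).reindex e, fun i j => ?_⟩
  have hc : ∀ i, ((Pi.basisFun ℝ (Fin 2)).reindex e).coord i = dx (e.symm i) := by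
    intro i
    ext v
    simp
  simp only [hc]
  generalize e.symm i = i'
  generalize e.symm j = j'
  obtain ⟨p, q, r, hpqr⟩ : ∃ p q r, ∀ x, planeQuad a₀ a₁ a₂ b₀ b₁ b₂ c₀ c₁ c₂ x (dx i') (dx j') =
      binaryForm p q r x := by
    simp only [planeQuad_apply]
    fin_cases i' <;> fin_cases j'
    · exact ⟨a₀, a₁, a₂, by simp⟩
    · exact ⟨b₀, b₁, b₂, by simp⟩
    · exact ⟨b₀, b₁, b₂, by simp⟩
    · exact ⟨c₀, c₁, c₂, by simp⟩
  -- The coefficient array need not be symmetric, so the whole mixed term is put above the diagonal.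
  refine ⟨fun l k => !![p, q; 0, r] (e.symm l) (e.symm k), fun x => ?_⟩
  rw [hpqr, ← e.sum_comp]
  simp only [← e.sum_comp, Equiv.symm_apply_apply, Fin.sum_univ_two, binaryForm]
  simp
  ring

/-- The space of binary quadratic forms. -/
def binaryForms : Submodule ℝ ((Fin 2 → ℝ) → ℝ) :=
  Submodule.span ℝ {fun v => v 0 ^ 2, fun v => v 0 * v 1, fun v => v 1 ^ 2}

theorem mem_binaryForms_iff {f : (Fin 2 → ℝ) → ℝ} :
    f ∈ binaryForms ↔ ∃ p q r, f = binaryForm p q r := by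
  rw [binaryForms, Submodule.mem_span_triple]
  refine exists_congr fun p => exists_congr fun q => exists_congr fun r => ?_
  rw [eq_comm]
  refine Eq.congr rfl ?_
  funext v
  simp [binaryForm, mul_assoc]

theorem mul_mem_binaryForms (α β : Module.Dual ℝ (Fin 2 → ℝ)) :
    (fun v => α v * β v) ∈ binaryForms := by
  have hd : ∀ (α : Module.Dual ℝ (Fin 2 → ℝ)) (v : Fin 2 → ℝ),
      α v = α (Pi.single 0 1) * v 0 + α (Pi.single 1 1) * v 1 := by
    intro α v
    conv_lhs => rw [dual_eq_sum_dx α]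
    simp [Fin.sum_univ_two]
  refine mem_binaryForms_iff.2 ⟨α (Pi.single 0 1) * β (Pi.single 0 1),
    α (Pi.single 0 1) * β (Pi.single 1 1) + α (Pi.single 1 1) * β (Pi.single 0 1),
    α (Pi.single 1 1) * β (Pi.single 1 1), ?_⟩
  funext v
  rw [hd α v, hd β v, binaryForm]
  ring

/-- This removes the unknown basis: products of linear functionals are binary quadratic forms in the
standard coordinates, and such forms make up a subspace. -/
theorem IsQuadratic.apply_mem_binaryForms {h : BivectorField (Fin 2 → ℝ)} (hh : h.IsQuadratic)
    (α β : Module.Dual ℝ (Fin 2 → ℝ)) : (fun x => h x α β) ∈ binaryForms := by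
  obtain ⟨b, hb⟩ := hh
  choose a ha using hb
  have hsum : ∀ α : Module.Dual ℝ (Fin 2 → ℝ), α = ∑ i, α (b i) • b.coord i := by
    intro α
    refine b.ext fun j => ?_
    simp
  have hf : (fun x => h x α β) = ∑ i, ∑ j, (α (b i) * β (b j)) •
      ∑ l, ∑ k, a i j l k • fun x => b.coord l x * b.coord k x := by
    funext x
    conv_lhs => rw [hsum α, hsum β]
    simp only [map_sum, map_smul, LinearMap.sum_apply, LinearMap.smul_apply, ha, smul_eq_mul,
      Finset.sum_apply, Pi.smul_apply, Finset.mul_sum]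
    rw [Finset.sum_comm]
    refine Finset.sum_congr rfl fun i _ => Finset.sum_congr rfl fun j _ =>
      Finset.sum_congr rfl fun l _ => Finset.sum_congr rfl fun k _ => ?_
    ring
  rw [hf]
  exact Submodule.sum_mem _ fun i _ => Submodule.sum_mem _ fun j _ => Submodule.smul_mem _ _ <|
    Submodule.sum_mem _ fun l _ => Submodule.sum_mem _ fun k _ => Submodule.smul_mem _ _ <|
    mul_mem_binaryForms _ _

theorem IsQuadraticPseudoHessian.exists_planeQuad {h : BivectorField (Fin 2 → ℝ)}
    (hh : h.IsQuadraticPseudoHessian) :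
    ∃ a₀ a₁ a₂ b₀ b₁ b₂ c₀ c₁ c₂, h = planeQuad a₀ a₁ a₂ b₀ b₁ b₂ c₀ c₁ c₂ ∧
      CodazziEqs a₀ a₁ a₂ b₀ b₁ b₂ c₀ c₁ c₂ := by
  obtain ⟨a₀, a₁, a₂, ha⟩ := mem_binaryForms_iff.1 (hh.2.apply_mem_binaryForms (dx 0) (dx 0))
  obtain ⟨b₀, b₁, b₂, hb⟩ := mem_binaryForms_iff.1 (hh.2.apply_mem_binaryForms (dx 0) (dx 1))
  obtain ⟨c₀, c₁, c₂, hc⟩ := mem_binaryForms_iff.1 (hh.2.apply_mem_binaryForms (dx 1) (dx 1))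
  have heq : h = planeQuad a₀ a₁ a₂ b₀ b₁ b₂ c₀ c₁ c₂ := by
    refine ext_gram fun x => ?_
    have hb' : h x (dx 1) (dx 0) = binaryForm b₀ b₁ b₂ x :=
      (hh.1.symm x _ _).trans (congrFun hb x)
    rw [planeQuad, gram_ofPlaneMatrix]
    ext i j
    fin_cases i <;> fin_cases j
    · exact congrFun ha x
    · exact congrFun hb x
    · exact hb'
    · exact congrFun hc x
  refine ⟨a₀, a₁, a₂, b₀, b₁, b₂, c₀, c₁, c₂, heq, ?_⟩
  rw [← isContravariantPseudoHessian_planeQuad_iff, ← heq]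
  exact hh.1

theorem CodazziEqs.isQuadraticPseudoHessian (hk : CodazziEqs a₀ a₁ a₂ b₀ b₁ b₂ c₀ c₁ c₂) :
    (planeQuad a₀ a₁ a₂ b₀ b₁ b₂ c₀ c₁ c₂).IsQuadraticPseudoHessian :=
  ⟨isContravariantPseudoHessian_planeQuad_iff.2 hk, isQuadratic_planeQuad⟩

/-- Parallelogram law: `f (x + t) + f (-x + t) = 2 f x + 2 f t`, where the left side is `2 g x` and
`f t = g 0 = 0`. -/
theorem eq_of_mem_binaryForms_of_translate {f g : (Fin 2 → ℝ) → ℝ} (hf : f ∈ binaryForms)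
    (hg : g ∈ binaryForms) (t : Fin 2 → ℝ) (hfg : ∀ x, f (x + t) = g x) : f = g := by
  obtain ⟨p, q, r, rfl⟩ := mem_binaryForms_iff.1 hf
  obtain ⟨p', q', r', rfl⟩ := mem_binaryForms_iff.1 hg
  funext x
  have h0 := hfg 0
  have h1 := hfg x
  have h2 := hfg (-x)
  simp only [binaryForm, Pi.add_apply, Pi.neg_apply, Pi.zero_apply] at h0 h1 h2 ⊢
  linear_combination (h1 + h2) / 2 - h0

/-- An affine isomorphism between quadratic bivector fields may be taken linear. -/
theorem AffineIsomorphic.exists_linear {h h' : BivectorField (Fin 2 → ℝ)}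
    (hiso : h.AffineIsomorphic h') (hh : h.IsQuadratic) (hh' : h'.IsQuadratic) :
    ∃ P : (Matrix (Fin 2) (Fin 2) ℝ)ˣ, h' = pushforward (unitEquiv P) h := by
  obtain ⟨F, hF⟩ := hiso
  obtain ⟨P, hP⟩ := exists_unitEquiv F.linear
  refine ⟨P, ?_⟩
  rw [hP]
  funext x
  refine LinearMap.ext fun α => LinearMap.ext fun β => ?_
  refine congrFun (eq_of_mem_binaryForms_of_translate (hh'.apply_mem_binaryForms α β)
    ((hh.pushforward F.linear).apply_mem_binaryForms α β) (F 0) fun y => ?_) x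
  -- `F` is its linear part followed by translation by `F 0`.
  have hy : y + F 0 = F (F.linear.symm y) := by
    have := F.map_vadd 0 (F.linear.symm y)
    simpa using this.symm
  simp only [hy, hF, pushforward_apply]

theorem gram_pushforward (P : (Matrix (Fin 2) (Fin 2) ℝ)ˣ) (h : BivectorField (Fin 2 → ℝ))
    (x : Fin 2 → ℝ) :
    gram (pushforward (unitEquiv P) h) (P.val.mulVec x) = P.val * gram h x * P.val.transpose := by
  ext i j
  rw [← unitEquiv_apply]
  simp only [gram, Matrix.of_apply, pushforward_apply, LinearEquiv.symm_apply_apply,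
    dx_comp_unitEquiv, Matrix.mul_apply, Matrix.transpose_apply, Fin.sum_univ_two, map_add,
    map_smul, LinearMap.add_apply, LinearMap.smul_apply, smul_eq_mul]
  ring

/-- An affine isomorphism between quadratic bivector fields in terms of matrices. -/
theorem AffineIsomorphic.exists_gram_eq {h h' : BivectorField (Fin 2 → ℝ)}
    (hiso : h.AffineIsomorphic h') (hh : h.IsQuadratic) (hh' : h'.IsQuadratic) :
    ∃ P : Matrix (Fin 2) (Fin 2) ℝ, P.det ≠ 0 ∧
      ∀ x, gram h' (P.mulVec x) = P * gram h x * P.transpose := by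
  obtain ⟨P, rfl⟩ := hiso.exists_linear hh hh'
  exact ⟨P.val, ((Matrix.isUnit_iff_isUnit_det _).1 P.isUnit).ne_zero, gram_pushforward P h⟩

theorem affineIsomorphic_of_gram_eq {h h' : BivectorField (Fin 2 → ℝ)}
    (P : Matrix (Fin 2) (Fin 2) ℝ) (hP : P.det ≠ 0)
    (hg : ∀ x, gram h' (P.mulVec x) = P * gram h x * P.transpose) : h.AffineIsomorphic h' := by
  obtain ⟨U, rfl⟩ := (Matrix.isUnit_iff_isUnit_det P).2 (isUnit_iff_ne_zero.2 hP)
  have heq : h' = pushforward (unitEquiv U) h := by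
    refine ext_gram fun x => ?_
    obtain ⟨y, rfl⟩ := (unitEquiv U).surjective x
    rw [unitEquiv_apply, hg, gram_pushforward]
  exact heq ▸ affineIsomorphic_pushforward _ _

theorem HasDivergenceMatrix.isConj {h h' : BivectorField (Fin 2 → ℝ)}
    {L L' : Matrix (Fin 2) (Fin 2) ℝ} (hL : h.HasDivergenceMatrix L)
    (hL' : h'.HasDivergenceMatrix L') (hh : h.IsQuadraticPseudoHessian)
    (hh' : h'.IsQuadraticPseudoHessian) (hiso : h.AffineIsomorphic h') : IsConj L L' := by
  obtain ⟨P, rfl⟩ := hiso.exists_linear hh.2 hh'.2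
  refine ⟨P, ?_⟩
  rw [hL'.unique (hL.pushforward hh.1 P), SemiconjBy, mul_assoc, mul_assoc, P.inv_val, mul_one]

end Plane

/-! ### The listed families: Codazzi equations and divergence matrices. -/

section NormalForms

theorem free₁_eq (u : ℝ) : free₁ u = planeQuad 0 0 0 0 0 0 u 0 0 := by
  unfold free₁ planeQuad
  congr! 5 <;> ring_nf

theorem free₂_eq (r c : ℝ) : free₂ r c = planeQuad (r ^ 2 / c) (-(2 * r)) c
    (r ^ 3 / c ^ 2) (-(2 * r ^ 2 / c)) r (r ^ 4 / c ^ 3) (-(2 * r ^ 3 / c ^ 2)) (r ^ 2 / c) := by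
  unfold free₂ planeQuad
  congr! 5 <;> ring_nf

theorem jordan₁_eq (c : ℝ) : jordan₁ c = planeQuad 0 1 c 0 0 0 0 0 0 := by
  unfold jordan₁ planeQuad
  congr! 5 <;> ring_nf

theorem jordan₂_eq (c : ℝ) : jordan₂ c = planeQuad 0 (1 / 2) c 0 0 (1 / 4) 0 0 0 := by
  unfold jordan₂ planeQuad
  congr! 5 <;> ring_nf

theorem diag₁_eq (a b : ℝ) : diag₁ a b = planeQuad a 0 0 0 0 0 0 0 b := by
  unfold diag₁ planeQuad
  congr! 5 <;> ring_nf

theorem diag₂_eq (a b : ℝ) : diag₂ a b = planeQuad a 0 b 0 0 0 0 0 0 := by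
  unfold diag₂ planeQuad
  congr! 5 <;> ring_nf

theorem diag₃_eq (a : ℝ) : diag₃ a = planeQuad a 0 0 0 a 0 0 0 a := by
  unfold diag₃ planeQuad
  congr! 5 <;> ring_nf

theorem diag₄_eq (r c : ℝ) : diag₄ r c =
    planeQuad (2 * r ^ 2 / c) (-(2 * r)) c 0 0 r 0 0 (2 * r ^ 2 / c) := by
  unfold diag₄ planeQuad
  congr! 5 <;> ring_nf

theorem diag₅_eq (p q u : ℝ) : diag₅ p q u =
    planeQuad (2 * p ^ 2 / u + q / 2) (p * q / u) (q ^ 2 / (4 * u))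
      p q (-(p * q / (2 * u))) u (-(2 * p)) (2 * p ^ 2 / u + q / 2) := by
  unfold diag₅ planeQuad
  congr! 5 <;> ring_nf

theorem nonReal_eq (p u : ℝ) : nonReal p u =
    planeQuad (-u) (-(2 * p)) u p (-(2 * u)) (-p) u (2 * p) (-u) := by
  unfold nonReal planeQuad
  congr! 5 <;> ring_nf

theorem isQuadraticPseudoHessian_free₁ (u : ℝ) : (free₁ u).IsQuadraticPseudoHessian := by
  rw [free₁_eq]
  apply CodazziEqs.isQuadraticPseudoHessian
  constructor <;> ring

theorem isQuadraticPseudoHessian_free₂ (r : ℝ) {c : ℝ} (hc : c ≠ 0) :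
    (free₂ r c).IsQuadraticPseudoHessian := by
  rw [free₂_eq]
  apply CodazziEqs.isQuadraticPseudoHessian
  constructor <;> field_simp <;> ring

theorem isQuadraticPseudoHessian_jordan₁ (c : ℝ) : (jordan₁ c).IsQuadraticPseudoHessian := by
  rw [jordan₁_eq]
  apply CodazziEqs.isQuadraticPseudoHessian
  constructor <;> ring

theorem isQuadraticPseudoHessian_jordan₂ (c : ℝ) : (jordan₂ c).IsQuadraticPseudoHessian := by
  rw [jordan₂_eq]
  apply CodazziEqs.isQuadraticPseudoHessian
  constructor <;> ring

theorem isQuadraticPseudoHessian_diag₁ (a b : ℝ) : (diag₁ a b).IsQuadraticPseudoHessian := by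
  rw [diag₁_eq]
  apply CodazziEqs.isQuadraticPseudoHessian
  constructor <;> ring

theorem isQuadraticPseudoHessian_diag₂ (a b : ℝ) : (diag₂ a b).IsQuadraticPseudoHessian := by
  rw [diag₂_eq]
  apply CodazziEqs.isQuadraticPseudoHessian
  constructor <;> ring

theorem isQuadraticPseudoHessian_diag₃ (a : ℝ) : (diag₃ a).IsQuadraticPseudoHessian := by
  rw [diag₃_eq]
  apply CodazziEqs.isQuadraticPseudoHessian
  constructor <;> ring

theorem isQuadraticPseudoHessian_diag₄ (r : ℝ) {c : ℝ} (hc : c ≠ 0) :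
    (diag₄ r c).IsQuadraticPseudoHessian := by
  rw [diag₄_eq]
  apply CodazziEqs.isQuadraticPseudoHessian
  constructor <;> field_simp <;> ring

theorem isQuadraticPseudoHessian_diag₅ (p q : ℝ) {u : ℝ} (hu : u ≠ 0) :
    (diag₅ p q u).IsQuadraticPseudoHessian := by
  rw [diag₅_eq]
  apply CodazziEqs.isQuadraticPseudoHessian
  constructor <;> field_simp <;> ring

theorem isQuadraticPseudoHessian_nonReal (p u : ℝ) : (nonReal p u).IsQuadraticPseudoHessian := by
  rw [nonReal_eq]
  apply CodazziEqs.isQuadraticPseudoHessian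
  constructor <;> ring

theorem isDivergenceFree_iff {h : BivectorField (Fin 2 → ℝ)} :
    h.IsDivergenceFree ↔ h.HasDivergenceMatrix 0 := by
  simp [IsDivergenceFree, HasDivergenceMatrix]

theorem isDivergenceFree_free₁ (u : ℝ) : (free₁ u).IsDivergenceFree := by
  rw [isDivergenceFree_iff, free₁_eq]
  convert hasDivergenceMatrix_planeQuad using 1
  ext i j
  fin_cases i <;> fin_cases j <;> simp

theorem isDivergenceFree_free₂ (r c : ℝ) : (free₂ r c).IsDivergenceFree := by
  rw [isDivergenceFree_iff, free₂_eq]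
  convert hasDivergenceMatrix_planeQuad using 1
  ext i j
  fin_cases i <;> fin_cases j <;> simp <;> ring

theorem hasDivergenceMatrix_jordan₁ (c : ℝ) :
    (jordan₁ c).HasDivergenceMatrix !![0, 1; 0, 0] := by
  rw [jordan₁_eq]
  convert hasDivergenceMatrix_planeQuad using 1
  ext i j
  fin_cases i <;> fin_cases j <;> simp

theorem hasDivergenceMatrix_jordan₂ (c : ℝ) :
    (jordan₂ c).HasDivergenceMatrix !![0, 1; 0, 0] := by
  rw [jordan₂_eq]
  convert hasDivergenceMatrix_planeQuad using 1
  ext i j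
  fin_cases i <;> fin_cases j <;> norm_num

theorem hasDivergenceMatrix_diag₁ (a b : ℝ) :
    (diag₁ a b).HasDivergenceMatrix (Matrix.diagonal ![2 * a, 2 * b]) := by
  rw [diag₁_eq]
  convert hasDivergenceMatrix_planeQuad using 1
  ext i j
  fin_cases i <;> fin_cases j <;> simp

theorem hasDivergenceMatrix_diag₂ (a b : ℝ) :
    (diag₂ a b).HasDivergenceMatrix (Matrix.diagonal ![2 * a, 0]) := by
  rw [diag₂_eq]
  convert hasDivergenceMatrix_planeQuad using 1
  ext i j
  fin_cases i <;> fin_cases j <;> simp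

theorem hasDivergenceMatrix_diag₃ (a : ℝ) :
    (diag₃ a).HasDivergenceMatrix (Matrix.diagonal fun _ => 3 * a) := by
  rw [diag₃_eq]
  convert hasDivergenceMatrix_planeQuad using 1
  ext i j
  fin_cases i <;> fin_cases j <;> simp <;> ring

theorem hasDivergenceMatrix_diag₄ (r c : ℝ) :
    (diag₄ r c).HasDivergenceMatrix (Matrix.diagonal fun _ => 4 * r ^ 2 / c) := by
  rw [diag₄_eq]
  convert hasDivergenceMatrix_planeQuad using 1
  ext i j
  fin_cases i <;> fin_cases j <;> simp <;> ring

theorem hasDivergenceMatrix_diag₅ (p q u : ℝ) :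
    (diag₅ p q u).HasDivergenceMatrix (Matrix.diagonal fun _ => 4 * p ^ 2 / u + 2 * q) := by
  rw [diag₅_eq]
  convert hasDivergenceMatrix_planeQuad using 1
  ext i j
  fin_cases i <;> fin_cases j <;> simp <;> ring

theorem hasDivergenceMatrix_nonReal (p u : ℝ) :
    (nonReal p u).HasDivergenceMatrix !![-(4 * u), -(4 * p); 4 * p, -(4 * u)] := by
  rw [nonReal_eq]
  convert hasDivergenceMatrix_planeQuad using 1
  ext i j
  fin_cases i <;> fin_cases j <;> simp <;> ring

theorem hasDiagonalizableDivergence_of_diagonal {h : BivectorField (Fin 2 → ℝ)} {d : Fin 2 → ℝ}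
    (hd : h.HasDivergenceMatrix (Matrix.diagonal d)) : h.HasDiagonalizableDivergence :=
  ⟨_, hd, d, IsConj.refl _⟩

theorem mem_spectrum_map_algebraMap_iff (L : Matrix (Fin 2) (Fin 2) ℝ) (z : ℂ) :
    z ∈ spectrum ℂ (L.map (algebraMap ℝ ℂ)) ↔
      (z - L 0 0) * (z - L 1 1) - L 0 1 * L 1 0 = 0 := by
  rw [spectrum.mem_iff, Matrix.isUnit_iff_isUnit_det, isUnit_iff_ne_zero, not_not,
    Matrix.det_fin_two]
  simp [Matrix.algebraMap_matrix_apply]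

theorem hasNonRealDivergence_nonReal {p : ℝ} (hp : p ≠ 0) (u : ℝ) :
    (nonReal p u).HasNonRealDivergence := by
  refine ⟨_, hasDivergenceMatrix_nonReal p u, -(4 * u) + 4 * p * Complex.I, ?_, by simpa⟩
  rw [mem_spectrum_map_algebraMap_iff]
  simp
  linear_combination (16 * p ^ 2 : ℂ) * Complex.I_sq

/-- A real matrix with a non-real eigenvalue is similar to a rotation-scaling matrix. -/
theorem exists_isConj_of_nonReal {L : Matrix (Fin 2) (Fin 2) ℝ} {z : ℂ}
    (hz : z ∈ spectrum ℂ (L.map (algebraMap ℝ ℂ))) (him : z.im ≠ 0) :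
    ∃ s t : ℝ, t ≠ 0 ∧ IsConj L !![s, t; -t, s] := by
  rw [mem_spectrum_map_algebraMap_iff, Complex.ext_iff] at hz
  obtain ⟨hre, himz⟩ := hz
  simp at hre himz
  have htr : 2 * z.re = L 0 0 + L 1 1 :=
    mul_right_cancel₀ him (by linear_combination himz)
  -- The imaginary part of the characteristic equation gave the trace; this is its real part with `L
  -- 1 1` eliminated. It shows that `L 0 1` cannot vanish.
  have hdet : z.im ^ 2 = -(L 0 0 - z.re) ^ 2 - L 0 1 * L 1 0 := by
    linear_combination -hre + (z.re - L 0 0) * htr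
  have hb : L 0 1 ≠ 0 := by
    intro hb
    rw [hb] at hdet
    have : 0 < z.im ^ 2 := by positivity
    nlinarith [sq_nonneg (L 0 0 - z.re)]
  -- With first row `(1, 0)`, the first row of `P L = N P` determines the second row of `P`.
  set P : Matrix (Fin 2) (Fin 2) ℝ := !![1, 0; (L 0 0 - z.re) / z.im, L 0 1 / z.im] with hP
  have hPu : IsUnit P := by
    rw [Matrix.isUnit_iff_isUnit_det, isUnit_iff_ne_zero, hP, Matrix.det_fin_two_of]
    simp [hb, him]
  refine ⟨z.re, z.im, him, hPu.unit, ?_⟩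
  rw [SemiconjBy, IsUnit.unit_spec]
  ext i j
  fin_cases i <;> fin_cases j <;> simp [hP, Matrix.mul_apply, Fin.sum_univ_two] <;> field_simp
  · ring
  · linear_combination hdet
  · linear_combination -htr

end NormalForms

/-! ### Solving the Codazzi equations for each normal form of the divergence. -/

section Classification

theorem exists_planeQuad_of_hasDivergenceMatrix {h : BivectorField (Fin 2 → ℝ)}
    (hh : h.IsQuadraticPseudoHessian) {l₀₀ l₀₁ l₁₀ l₁₁ : ℝ}
    (hL : h.HasDivergenceMatrix !![l₀₀, l₀₁; l₁₀, l₁₁]) :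
    ∃ a₀ a₁ a₂ b₀ b₁ b₂ c₀ c₁ c₂, h = planeQuad a₀ a₁ a₂ b₀ b₁ b₂ c₀ c₁ c₂ ∧
      CodazziEqs a₀ a₁ a₂ b₀ b₁ b₂ c₀ c₁ c₂ ∧ 2 * a₀ + b₁ = l₀₀ ∧ a₁ + 2 * b₂ = l₀₁ ∧
      2 * b₀ + c₁ = l₁₀ ∧ b₁ + 2 * c₂ = l₁₁ := by
  obtain ⟨a₀, a₁, a₂, b₀, b₁, b₂, c₀, c₁, c₂, rfl, hk⟩ := hh.exists_planeQuad
  have heq := hasDivergenceMatrix_planeQuad.unique hL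
  refine ⟨a₀, a₁, a₂, b₀, b₁, b₂, c₀, c₁, c₂, rfl, hk, ?_, ?_, ?_, ?_⟩
  · simpa using congrFun (congrFun heq 0) 0
  · simpa using congrFun (congrFun heq 0) 1
  · simpa using congrFun (congrFun heq 1) 0
  · simpa using congrFun (congrFun heq 1) 1

/-- No change of coordinates is needed. If the `y ^ 2` coefficient `α` of `h₀₀` vanishes, squares of
the remaining unknowns are forced to vanish one after another, except `ε`. If `α ≠ 0`, then `γ`,
`δ`, `ε` are solved for in terms of `α` and `β`. -/
theorem eq_free₁_or_eq_free₂ {h : BivectorField (Fin 2 → ℝ)} (hh : h.IsQuadraticPseudoHessian)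
    (hL : h.IsDivergenceFree) : (∃ u, h = free₁ u) ∨ ∃ r c, c ≠ 0 ∧ h = free₂ r c := by
  rw [isDivergenceFree_iff, Matrix.eta_fin_two 0] at hL
  obtain ⟨a₀, a₁, α, δ, γ, β, ε, c₁, c₂, rfl, hk, e₀, e₁, e₂, e₃⟩ :=
    exists_planeQuad_of_hasDivergenceMatrix hh hL
  simp only [Matrix.zero_apply] at e₀ e₁ e₂ e₃
  obtain rfl : a₀ = -γ / 2 := by linarith
  obtain rfl : a₁ = -(2 * β) := by linarith
  obtain rfl : c₁ = -(2 * δ) := by linarith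
  obtain rfl : c₂ = -γ / 2 := by linarith
  obtain ⟨f₀, f₁, f₂, f₃, g₀, g₁, g₂, g₃⟩ := hk
  by_cases hα : α = 0
  · subst hα
    have hβ : β = 0 := pow_eq_zero_iff two_ne_zero |>.1 (by linear_combination f₃ / 4)
    subst hβ
    have hγ : γ = 0 := pow_eq_zero_iff two_ne_zero |>.1 (by linear_combination 2 * f₁ / 3)
    subst hγ
    have hδ : δ = 0 := pow_eq_zero_iff two_ne_zero |>.1 (by linear_combination -g₀ / 4)
    subst hδ
    exact Or.inl ⟨ε, by rw [free₁_eq]; simp⟩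
  · have hγ : γ = -(2 * β ^ 2 / α) := by
      field_simp
      linear_combination f₃ / 2
    have hδ : δ = β ^ 3 / α ^ 2 := by
      subst hγ
      field_simp at g₃ ⊢
      linear_combination -g₃ / 2
    have hε : ε = β ^ 4 / α ^ 3 := by
      subst hγ hδ
      field_simp at f₁ ⊢
      linear_combination -f₁ / 2
    subst hγ hδ hε
    refine Or.inr ⟨β, α, hα, ?_⟩
    rw [free₂_eq]
    congr 1 <;> field_simp

theorem eq_jordan₁_or_eq_jordan₂ {h : BivectorField (Fin 2 → ℝ)}
    (hh : h.IsQuadraticPseudoHessian) {a : ℝ} (hL : h.HasDivergenceMatrix !![a, 1; 0, a]) :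
    (∃ c, h = jordan₁ c) ∨ ∃ c, h = jordan₂ c := by
  obtain ⟨a₀, a₁, α, δ, γ, β, ε, c₁, c₂, rfl, hk, e₀, e₁, e₂, e₃⟩ :=
    exists_planeQuad_of_hasDivergenceMatrix hh hL
  obtain rfl : a₀ = (a - γ) / 2 := by linarith
  obtain rfl : a₁ = 1 - 2 * β := by linarith
  obtain rfl : c₁ = -(2 * δ) := by linarith
  obtain rfl : c₂ = (a - γ) / 2 := by linarith
  obtain ⟨f₀, f₁, f₂, f₃, g₀, g₁, g₂, g₃⟩ := hk
  -- Symmetry of `L h` reads `h₁₁ = 0` here: its coefficients are `ε`, `-2 δ` and `(a - γ) / 2`.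
  have hδ : δ = 0 := by linear_combination f₁ + g₂
  subst hδ
  have hγ : γ = a := by linear_combination 2 * f₂ + 6 * g₃
  subst hγ
  have hε : ε = 0 := by linear_combination -g₁ - 3 * f₀
  subst hε
  -- Now `γ` is the eigenvalue of the Jordan block, so this shows that the block is nilpotent.
  have hγ : γ = 0 := pow_eq_zero_iff two_ne_zero |>.1 (by linear_combination f₁)
  subst hγ
  have hβ : β * (4 * β - 1) = 0 := by linear_combination f₃
  rcases mul_eq_zero.1 hβ with rfl | hβ
  · exact Or.inl ⟨α, by rw [jordan₁_eq]; simp⟩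
  · obtain rfl : β = 1 / 4 := by linarith
    refine Or.inr ⟨α, ?_⟩
    rw [jordan₂_eq]
    congr 1 <;> norm_num

theorem eq_nonReal {h : BivectorField (Fin 2 → ℝ)} (hh : h.IsQuadraticPseudoHessian) {s t : ℝ}
    (ht : t ≠ 0) (hL : h.HasDivergenceMatrix !![s, t; -t, s]) :
    ∃ p u, p ≠ 0 ∧ h = nonReal p u := by
  obtain ⟨a₀, a₁, α, δ, γ, β, ε, c₁, c₂, rfl, hk, e₀, e₁, e₂, e₃⟩ :=
    exists_planeQuad_of_hasDivergenceMatrix hh hL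
  obtain rfl : a₀ = (s - γ) / 2 := by linarith
  obtain rfl : a₁ = t - 2 * β := by linarith
  obtain rfl : c₁ = -t - 2 * δ := by linarith
  obtain rfl : c₂ = (s - γ) / 2 := by linarith
  obtain ⟨f₀, f₁, f₂, f₃, g₀, g₁, g₂, g₃⟩ := hk
  -- Symmetry of `L h` reads `t (h₀₀ + h₁₁) = 0`, compared coefficient by coefficient.
  have hδ : δ = -β := mul_left_cancel₀ ht (by linear_combination f₁ + g₂)
  subst hδ
  have hs : s = γ - 2 * α := mul_left_cancel₀ ht (by linear_combination -2 * f₂ - 6 * g₃)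
  subst hs
  have hε : ε = α := mul_left_cancel₀ ht (by linear_combination -g₁ - 3 * f₀)
  subst hε
  -- A linear system in `γ + 2 ε` and `4 β - t` whose determinant is `-(ε ^ 2 + β ^ 2)`; this is
  -- nonzero because `ε = β = 0` would give `γ ^ 2 + t ^ 2 = 0`.
  have i₁ : ε * (γ + 2 * ε) + β * (4 * β - t) = 0 := by linear_combination f₃
  have i₂ : β * (γ + 2 * ε) - ε * (4 * β - t) = 0 := by linear_combination -g₃
  have hX : (ε ^ 2 + β ^ 2) * (γ + 2 * ε) = 0 := by linear_combination ε * i₁ + β * i₂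
  have hY : (ε ^ 2 + β ^ 2) * (4 * β - t) = 0 := by linear_combination β * i₁ - ε * i₂
  have hne : ε ^ 2 + β ^ 2 ≠ 0 := by
    intro h0
    have hε : ε = 0 := by nlinarith [sq_nonneg ε, sq_nonneg β]
    have hβ : β = 0 := by nlinarith [sq_nonneg ε, sq_nonneg β]
    subst hε hβ
    have : γ ^ 2 + t ^ 2 = 0 := by linear_combination f₁
    have : 0 < t ^ 2 := by positivity
    nlinarith [sq_nonneg γ]
  have hγ : γ = -(2 * ε) := by linarith [(mul_eq_zero.1 hX).resolve_left hne]
  have ht' : t = 4 * β := by linarith [(mul_eq_zero.1 hY).resolve_left hne]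
  subst hγ ht'
  refine ⟨-β, ε, fun h0 => ht (by linarith), ?_⟩
  rw [nonReal_eq]
  congr 1 <;> ring

/-- The image of `planeQuad` under the exchange of the two coordinates. -/
theorem affineIsomorphic_swap (a₀ a₁ a₂ b₀ b₁ b₂ c₀ c₁ c₂ : ℝ) :
    (planeQuad a₀ a₁ a₂ b₀ b₁ b₂ c₀ c₁ c₂).AffineIsomorphic
      (planeQuad c₂ c₁ c₀ b₂ b₁ b₀ a₂ a₁ a₀) := by
  refine affineIsomorphic_of_gram_eq !![0, 1; 1, 0] (by simp) fun x => ?_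
  simp only [planeQuad, gram_ofPlaneMatrix]
  ext i j
  fin_cases i <;> fin_cases j <;>
    simp [Matrix.mul_apply, Matrix.mulVec, dotProduct, Fin.sum_univ_two] <;> ring

/-- Scalar divergence `l` with `x ^ 2` coefficient `u ≠ 0` in `h₁₁`: dividing by `u`, the equations
give `l`, `β` and `α` in turn in terms of `p`, `q`, `u`. -/
theorem eq_diag₅ {l p q u β α a₀ a₁ c₁ c₂ : ℝ} (hk : CodazziEqs a₀ a₁ α p q β u c₁ c₂)
    (e₀ : 2 * a₀ + q = l) (e₁ : a₁ + 2 * β = 0) (e₂ : 2 * p + c₁ = 0) (e₃ : q + 2 * c₂ = l)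
    (hu : u ≠ 0) : planeQuad a₀ a₁ α p q β u c₁ c₂ = diag₅ p q u := by
  obtain rfl : a₀ = (l - q) / 2 := by linarith
  obtain rfl : a₁ = -(2 * β) := by linarith
  obtain rfl : c₁ = -(2 * p) := by linarith
  obtain rfl : c₂ = (l - q) / 2 := by linarith
  obtain ⟨f₀, f₁, f₂, f₃, g₀, g₁, g₂, g₃⟩ := hk
  have hl : l = 2 * q + 4 * p ^ 2 / u := by
    field_simp
    linear_combination g₀
  subst hl
  have hβ : β = -(p * q / (2 * u)) := by
    field_simp
    linear_combination f₀
  subst hβ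
  have hα : α = q ^ 2 / (4 * u) := by
    field_simp at f₁ ⊢
    exact mul_left_cancel₀ hu (by linear_combination -f₁)
  subst hα
  rw [diag₅_eq]
  congr 1 <;> field_simp <;> ring

/-- `diag₄` is not needed among the alternatives: fields of scalar divergence with `ε = 0` and `α ≠
0` become members of `diag₅` after exchanging the coordinates. -/
theorem classification_of_diagonal {h : BivectorField (Fin 2 → ℝ)}
    (hh : h.IsQuadraticPseudoHessian) {l₁ l₂ : ℝ}
    (hL : h.HasDivergenceMatrix !![l₁, 0; 0, l₂]) :
    (∃ a b, h.AffineIsomorphic (diag₁ a b)) ∨ (∃ a b, h.AffineIsomorphic (diag₂ a b)) ∨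
      (∃ a, h.AffineIsomorphic (diag₃ a)) ∨
      ∃ p q u, u ≠ 0 ∧ h.AffineIsomorphic (diag₅ p q u) := by
  obtain ⟨a₀, a₁, α, δ, γ, β, ε, c₁, c₂, rfl, hk, e₀, e₁, e₂, e₃⟩ :=
    exists_planeQuad_of_hasDivergenceMatrix hh hL
  by_cases hl : l₁ = l₂
  · subst hl
    by_cases hε : ε = 0
    · by_cases hα : α = 0
      · subst hε hα
        obtain rfl : a₀ = (l₁ - γ) / 2 := by linarith
        obtain rfl : a₁ = -(2 * β) := by linarith
        obtain rfl : c₁ = -(2 * δ) := by linarith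
        obtain rfl : c₂ = (l₁ - γ) / 2 := by linarith
        obtain ⟨f₀, f₁, f₂, f₃, g₀, g₁, g₂, g₃⟩ := hk
        have hβ : β = 0 := pow_eq_zero_iff two_ne_zero |>.1 (by linear_combination f₃ / 4)
        have hδ : δ = 0 := pow_eq_zero_iff two_ne_zero |>.1 (by linear_combination -g₀ / 4)
        subst hβ hδ
        have hγ : γ * (3 * γ - l₁) = 0 := by linear_combination 2 * f₁
        rcases mul_eq_zero.1 hγ with rfl | hγ
        · refine Or.inl ⟨l₁ / 2, l₁ / 2, ?_⟩
          rw [diag₁_eq]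
          simpa using AffineIsomorphic.refl _
        · obtain rfl : l₁ = 3 * γ := by linarith
          refine Or.inr (Or.inr (Or.inl ⟨γ, ?_⟩))
          have hγ' : (3 * γ - γ) / 2 = γ := by ring
          rw [diag₃_eq, hγ']
          simpa using AffineIsomorphic.refl _
      · have h' := affineIsomorphic_swap a₀ a₁ α δ γ β ε c₁ c₂
        -- The exchange interchanges the two cubics, reverses the order of their coefficients, and
        -- changes the sign by antisymmetry.
        have hk' : CodazziEqs c₂ c₁ ε β γ δ α a₁ a₀ := by
          obtain ⟨f₀, f₁, f₂, f₃, g₀, g₁, g₂, g₃⟩ := hk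
          constructor
          · linear_combination -g₃
          · linear_combination -g₂
          · linear_combination -g₁
          · linear_combination -g₀
          · linear_combination -f₃
          · linear_combination -f₂
          · linear_combination -f₁
          · linear_combination -f₀
        rw [eq_diag₅ (l := l₁) hk' (by linarith) (by linarith) (by linarith) (by linarith) hα]
          at h'
        exact Or.inr (Or.inr (Or.inr ⟨β, γ, α, hα, h'⟩))
    · rw [eq_diag₅ hk e₀ e₁ e₂ e₃ hε]
      exact Or.inr (Or.inr (Or.inr ⟨δ, γ, ε, hε, AffineIsomorphic.refl _⟩))
  · obtain rfl : a₀ = (l₁ - γ) / 2 := by linarith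
    obtain rfl : a₁ = -(2 * β) := by linarith
    obtain rfl : c₁ = -(2 * δ) := by linarith
    obtain rfl : c₂ = (l₂ - γ) / 2 := by linarith
    obtain ⟨f₀, f₁, f₂, f₃, g₀, g₁, g₂, g₃⟩ := hk
    have hl' : l₁ - l₂ ≠ 0 := sub_ne_zero.2 hl
    -- Symmetry of `L h` reads `(l₁ - l₂) h₀₁ = 0`.
    have hβ : β = 0 := mul_left_cancel₀ hl' (by linear_combination -f₂ - 3 * g₃)
    have hδ : δ = 0 := mul_left_cancel₀ hl' (by linear_combination -g₁ - 3 * f₀)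
    have hγ : γ = 0 := mul_left_cancel₀ hl' (by linear_combination -2 * f₁ - 2 * g₂)
    subst hβ hδ hγ
    have hαε : α * ε = 0 := by linear_combination -f₁ / 2
    have hα : α * l₂ = 0 := by linear_combination -f₃
    have hε : ε * l₁ = 0 := by linear_combination g₀
    by_cases hα0 : α = 0
    · subst hα0
      by_cases hε0 : ε = 0
      · subst hε0
        refine Or.inl ⟨l₁ / 2, l₂ / 2, ?_⟩
        rw [diag₁_eq]
        simpa using AffineIsomorphic.refl _
      · obtain rfl := (mul_eq_zero.1 hε).resolve_left hε0
        refine Or.inr (Or.inl ⟨l₂ / 2, ε, ?_⟩)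
        rw [diag₂_eq]
        simpa using affineIsomorphic_swap 0 0 0 0 0 0 ε 0 (l₂ / 2)
    · obtain rfl := (mul_eq_zero.1 hα).resolve_left hα0
      obtain rfl := (mul_eq_zero.1 hαε).resolve_left hα0
      refine Or.inr (Or.inl ⟨l₁ / 2, α, ?_⟩)
      rw [diag₂_eq]
      simpa using AffineIsomorphic.refl _

end Classification

/-! ### Explicit isomorphisms and the sign invariant. -/

section Isomorphisms

theorem affineIsomorphic_ofPlaneMatrix {m m' : ℝ → ℝ → Matrix (Fin 2) (Fin 2) ℝ} (p q r s : ℝ)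
    (hdet : p * s - q * r ≠ 0)
    (hm : ∀ x y, m' (p * x + q * y) (r * x + s * y) = !![p, q; r, s] * m x y * !![p, r; q, s]) :
    (ofPlaneMatrix m).AffineIsomorphic (ofPlaneMatrix m') := by
  refine affineIsomorphic_of_gram_eq !![p, q; r, s] (by rwa [Matrix.det_fin_two_of]) fun x => ?_
  rw [gram_ofPlaneMatrix, gram_ofPlaneMatrix]
  convert hm (x 0) (x 1) using 2
  · simp [Matrix.mulVec, dotProduct, Fin.sum_univ_two]
  · simp [Matrix.mulVec, dotProduct, Fin.sum_univ_two]
  · ext i j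
    fin_cases i <;> fin_cases j <;> rfl

theorem free₂_affineIsomorphic_free₁ (r : ℝ) {c : ℝ} (hc : c ≠ 0) :
    (free₂ r c).AffineIsomorphic (free₁ c) := by
  -- The field `free₂ r c` is `c (y - (r / c) x) ^ 2` times the square of the constant vector `(1, r
  -- / c)`. The map takes that linear form as first coordinate and sends the vector to `(0, 1)`.
  refine affineIsomorphic_ofPlaneMatrix (-(r / c)) 1 1 0 (by simp) fun x y => ?_
  ext i j
  fin_cases i <;> fin_cases j <;> simp [Matrix.mul_apply, Fin.sum_univ_two] <;> field_simp <;> ring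

theorem diag₄_affineIsomorphic_diag₁ {r c : ℝ} (hr : r ≠ 0) (hc : c ≠ 0) :
    (diag₄ r c).AffineIsomorphic (diag₁ (2 * r ^ 2 / c) (2 * r ^ 2 / c)) := by
  -- The shear is the one that removes the off-diagonal entry `r y ^ 2` by means of `2 r ^ 2 y ^ 2 /
  -- c`.
  refine affineIsomorphic_ofPlaneMatrix 1 (-(c / (2 * r))) 0 1 (by simp) fun x y => ?_
  ext i j
  fin_cases i <;> fin_cases j <;> simp [Matrix.mul_apply, Fin.sum_univ_two] <;> field_simp <;> ring

theorem free₁_affineIsomorphic_iff (u u' : ℝ) :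
    (free₁ u).AffineIsomorphic (free₁ u') ↔ SignType.sign u = SignType.sign u' := by
  constructor
  · intro hiso
    obtain ⟨P, hdet, hP⟩ := hiso.exists_gram_eq (isQuadraticPseudoHessian_free₁ u).2
      (isQuadraticPseudoHessian_free₁ u').2
    rw [Matrix.det_fin_two] at hdet
    have key : ∀ (i j : Fin 2) (x y : ℝ), _ := fun i j x y =>
      congrFun (congrFun (hP ![x, y]) i) j
    simp only [free₁, gram_ofPlaneMatrix] at key
    have k₀ := key 0 0
    have k₁ := key 1 1
    simp [Matrix.mul_apply, Matrix.mulVec, dotProduct, Fin.sum_univ_two] at k₀ k₁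
    by_cases hu : u = 0
    · subst hu
      have h₀ := k₁ 1 0
      have h₁ := k₁ 0 1
      simp at h₀ h₁
      by_cases hu' : u' = 0
      · rw [hu']
      · simp [h₀.resolve_left hu', h₁.resolve_left hu'] at hdet
    -- The top left entry is zero in the target and `u (P 0 1) ^ 2 x ^ 2` after transport. Then the
    -- lower right entries give `u' (P 0 0) ^ 2 = u (P 1 1) ^ 2`, so the signs agree.
    · have hq : P 0 1 = 0 := by
        simpa [hu] using k₀ 1
      rw [hq, zero_mul, sub_zero] at hdet
      have hp := left_ne_zero_of_mul hdet
      have hs := right_ne_zero_of_mul hdet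
      have h₁ := k₁ 1 0
      simp only [mul_one, mul_zero, add_zero] at h₁
      have hp' : 0 < P 0 0 ^ 2 := by positivity
      have hs' : 0 < P 1 1 ^ 2 := by positivity
      calc SignType.sign u = SignType.sign (u * P 1 1 ^ 2) := by
            rw [sign_mul, sign_pos hs', mul_one]
        _ = SignType.sign (u' * P 0 0 ^ 2) := by
            congr 1
            linear_combination -h₁
        _ = SignType.sign u' := by rw [sign_mul, sign_pos hp', mul_one]
  · intro hs
    by_cases hu : u = 0
    · subst hu
      rw [sign_zero, eq_comm, sign_eq_zero_iff] at hs
      rw [hs]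
      exact AffineIsomorphic.refl _
    · have hpos : 0 < u' / u := by
        rcases lt_or_gt_of_ne hu with h | h
        · rw [sign_neg h, eq_comm, sign_eq_neg_one_iff] at hs
          exact div_pos_of_neg_of_neg hs h
        · rw [sign_pos h, eq_comm, sign_eq_one_iff] at hs
          exact div_pos hs h
      have hsq : u * √(u' / u) ^ 2 = u' := by
        rw [Real.sq_sqrt hpos.le]
        field_simp
      refine affineIsomorphic_ofPlaneMatrix 1 0 0 √(u' / u)
        (by simpa using (Real.sqrt_pos.2 hpos).ne') fun x y => ?_
      ext i j
      fin_cases i <;> fin_cases j <;> simp [Matrix.mul_apply, Fin.sum_univ_two]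
      linear_combination -x ^ 2 * hsq

end Isomorphisms

/-! ### Invariants separating the families. -/

section NonIsomorphic

theorem AffineIsomorphic.exists_det_gram {h h' : BivectorField (Fin 2 → ℝ)}
    (hiso : h.AffineIsomorphic h') (hh : h.IsQuadraticPseudoHessian)
    (hh' : h'.IsQuadraticPseudoHessian) :
    ∃ (F : (Fin 2 → ℝ) ≃ₗ[ℝ] (Fin 2 → ℝ)) (k : ℝ), k ≠ 0 ∧
      ∀ x, (gram h' (F x)).det = k * (gram h x).det := by
  obtain ⟨P, rfl⟩ := hiso.exists_linear hh.2 hh'.2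
  refine ⟨unitEquiv P, P.val.det ^ 2,
    pow_ne_zero 2 ((Matrix.isUnit_iff_isUnit_det _).1 P.isUnit).ne_zero, fun x => ?_⟩
  rw [unitEquiv_apply, gram_pushforward, Matrix.det_mul, Matrix.det_mul, Matrix.det_transpose]
  ring

theorem AffineIsomorphic.det_gram_eq_zero_iff {h h' : BivectorField (Fin 2 → ℝ)}
    (hiso : h.AffineIsomorphic h') (hh : h.IsQuadraticPseudoHessian)
    (hh' : h'.IsQuadraticPseudoHessian) :
    (∀ x, (gram h x).det = 0) ↔ ∀ x, (gram h' x).det = 0 := by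
  obtain ⟨F, k, hk, hF⟩ := hiso.exists_det_gram hh hh'
  refine Iff.trans (forall_congr' fun x => ?_) F.surjective.forall.symm
  rw [hF, mul_eq_zero, or_iff_right hk]

/-- Nonzero zeros of the determinant are preserved. -/
theorem AffineIsomorphic.exists_det_gram_eq_zero {h h' : BivectorField (Fin 2 → ℝ)}
    (hiso : h.AffineIsomorphic h') (hh : h.IsQuadraticPseudoHessian)
    (hh' : h'.IsQuadraticPseudoHessian) (hz : ∃ x, x ≠ 0 ∧ (gram h' x).det = 0) :
    ∃ x, x ≠ 0 ∧ (gram h x).det = 0 := by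
  obtain ⟨F, k, hk, hF⟩ := hiso.exists_det_gram hh hh'
  obtain ⟨y, hy, hdet⟩ := hz
  obtain ⟨x, rfl⟩ := F.surjective y
  exact ⟨x, by simpa using hy, by simpa [hF, hk] using hdet⟩

theorem det_gram_jordan₁ (c : ℝ) (x : Fin 2 → ℝ) : (gram (jordan₁ c) x).det = 0 := by
  rw [jordan₁, gram_ofPlaneMatrix, Matrix.det_fin_two_of]
  ring

theorem det_gram_jordan₂ (c : ℝ) (x : Fin 2 → ℝ) :
    (gram (jordan₂ c) x).det = -(x 1 ^ 4 / 16) := by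
  rw [jordan₂, gram_ofPlaneMatrix, Matrix.det_fin_two_of]
  ring

theorem det_gram_diag₁ (a b : ℝ) (x : Fin 2 → ℝ) :
    (gram (diag₁ a b) x).det = a * b * (x 0 * x 1) ^ 2 := by
  rw [diag₁, gram_ofPlaneMatrix, Matrix.det_fin_two_of]
  ring

theorem det_gram_diag₂ (a b : ℝ) (x : Fin 2 → ℝ) : (gram (diag₂ a b) x).det = 0 := by
  rw [diag₂, gram_ofPlaneMatrix, Matrix.det_fin_two_of]
  ring

theorem det_gram_diag₃ (a : ℝ) (x : Fin 2 → ℝ) : (gram (diag₃ a) x).det = 0 := by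
  rw [diag₃, gram_ofPlaneMatrix, Matrix.det_fin_two_of]
  ring

theorem det_gram_diag₄ (r : ℝ) {c : ℝ} (hc : c ≠ 0) (x : Fin 2 → ℝ) :
    (gram (diag₄ r c) x).det = (2 * r ^ 2 / c * x 0 - r * x 1) ^ 2 * x 1 ^ 2 := by
  rw [diag₄, gram_ofPlaneMatrix, Matrix.det_fin_two_of]
  field_simp
  ring

/-- The discriminant of the squared quadratic form is `2 (2 p ^ 2 + q u)`, so the same quantity
governs the leading factor and the real zeros. -/
theorem det_gram_diag₅ (p q : ℝ) {u : ℝ} (hu : u ≠ 0) (x : Fin 2 → ℝ) :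
    (gram (diag₅ p q u) x).det = (2 * p ^ 2 + q * u) / (2 * u ^ 2) *
      (u * x 0 ^ 2 - 2 * p * x 0 * x 1 - q / 2 * x 1 ^ 2) ^ 2 := by
  rw [diag₅, gram_ofPlaneMatrix, Matrix.det_fin_two_of]
  field_simp
  ring

theorem det_gram_diag₅_ne_zero {p q u : ℝ} (hu : u ≠ 0) (hneg : 2 * p ^ 2 + q * u < 0)
    {x : Fin 2 → ℝ} (hx : x ≠ 0) : (gram (diag₅ p q u) x).det ≠ 0 := by
  rw [det_gram_diag₅ p q hu]
  refine mul_ne_zero (div_ne_zero hneg.ne (by positivity)) (pow_ne_zero 2 fun h0 => hx ?_)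
  -- Completing the square after multiplying the form by `2 u`: it is definite when `2 p ^ 2 + q u <
  -- 0`.
  have hsum : 2 * (u * x 0 - p * x 1) ^ 2 + -(2 * p ^ 2 + q * u) * x 1 ^ 2 = 0 := by
    linear_combination 2 * u * h0
  have hnn : 0 ≤ -(2 * p ^ 2 + q * u) * x 1 ^ 2 := mul_nonneg (by linarith) (sq_nonneg _)
  have hx₁ : x 1 = 0 := by
    have : -(2 * p ^ 2 + q * u) * x 1 ^ 2 = 0 := by linarith [sq_nonneg (u * x 0 - p * x 1)]
    simpa using (mul_eq_zero.1 this).resolve_left (neg_ne_zero.2 hneg.ne)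
  have hx₀ : x 0 = 0 := by
    rw [hx₁] at h0
    simpa [hu] using h0
  ext i
  fin_cases i
  · exact hx₀
  · exact hx₁

theorem jordan₁_not_affineIsomorphic_jordan₂ (c c' : ℝ) :
    ¬ (jordan₁ c).AffineIsomorphic (jordan₂ c') := by
  intro hiso
  have key := (hiso.det_gram_eq_zero_iff (isQuadraticPseudoHessian_jordan₁ c)
    (isQuadraticPseudoHessian_jordan₂ c')).1 (det_gram_jordan₁ c) ![0, 1]
  rw [det_gram_jordan₂] at key
  norm_num at key

/-- Scalar matrices are central, hence alone in their conjugacy class. -/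
theorem eq_of_isConj_diagonal_const {L : Matrix (Fin 2) (Fin 2) ℝ} {k : ℝ}
    (hL : IsConj L (Matrix.diagonal fun _ => k)) : L = Matrix.diagonal fun _ => k := by
  obtain ⟨P, hP⟩ := hL
  have hk : (Matrix.diagonal fun _ => k : Matrix (Fin 2) (Fin 2) ℝ) = k • 1 := by
    rw [Matrix.smul_one_eq_diagonal]
  rw [hk, SemiconjBy, smul_mul_assoc, one_mul, ← mul_smul_one] at hP
  rw [hk]
  exact P.isUnit.mul_left_cancel (hP.trans (by simp))

theorem AffineIsomorphic.eq_of_hasDivergenceMatrix_const_right {h h' : BivectorField (Fin 2 → ℝ)}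
    (hiso : h.AffineIsomorphic h') (hh : h.IsQuadraticPseudoHessian)
    (hh' : h'.IsQuadraticPseudoHessian) {d : Fin 2 → ℝ} {k : ℝ}
    (hd : h.HasDivergenceMatrix (Matrix.diagonal d))
    (hk : h'.HasDivergenceMatrix (Matrix.diagonal fun _ => k)) (i : Fin 2) : d i = k := by
  have heq := eq_of_isConj_diagonal_const (hd.isConj hk hh hh' hiso)
  exact congrFun (Matrix.diagonal_injective heq) i

theorem AffineIsomorphic.eq_of_hasDivergenceMatrix_const_left {h h' : BivectorField (Fin 2 → ℝ)}
    (hiso : h.AffineIsomorphic h') (hh : h.IsQuadraticPseudoHessian)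
    (hh' : h'.IsQuadraticPseudoHessian) {d : Fin 2 → ℝ} {k : ℝ}
    (hk : h.HasDivergenceMatrix (Matrix.diagonal fun _ => k))
    (hd : h'.HasDivergenceMatrix (Matrix.diagonal d)) (i : Fin 2) : d i = k := by
  have heq := eq_of_isConj_diagonal_const (hk.isConj hd hh hh' hiso).symm
  exact congrFun (Matrix.diagonal_injective heq) i

/-- `diag₃`, `diag₄` and `diag₅` have scalar divergence, which `a ≠ b` excludes; `diag₂` has
identically vanishing determinant, which `a b ≠ 0` excludes. -/
theorem diag₁_not_affineIsomorphic {a b : ℝ} (ha : a ≠ 0) (hb : b ≠ 0) (hab : a ≠ b) :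
    (∀ a' b' : ℝ, ¬ (diag₁ a b).AffineIsomorphic (diag₂ a' b')) ∧
    (∀ a' : ℝ, ¬ (diag₁ a b).AffineIsomorphic (diag₃ a')) ∧
    (∀ r c : ℝ, c ≠ 0 → ¬ (diag₁ a b).AffineIsomorphic (diag₄ r c)) ∧
    (∀ p q u : ℝ, u ≠ 0 → ¬ (diag₁ a b).AffineIsomorphic (diag₅ p q u)) := by
  have hscalar : ∀ {h' : BivectorField (Fin 2 → ℝ)} {k : ℝ}, h'.IsQuadraticPseudoHessian →
      h'.HasDivergenceMatrix (Matrix.diagonal fun _ => k) →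
      ¬ (diag₁ a b).AffineIsomorphic h' := by
    intro h' k hh' hk hiso
    have key := hiso.eq_of_hasDivergenceMatrix_const_right (isQuadraticPseudoHessian_diag₁ a b) hh'
      (hasDivergenceMatrix_diag₁ a b) hk
    have h₀ : 2 * a = k := key 0
    have h₁ : 2 * b = k := key 1
    exact hab (by linarith)
  refine ⟨fun a' b' hiso => ?_, fun a' => ?_, fun r c hc => ?_, fun p q u hu => ?_⟩
  · have key := (hiso.det_gram_eq_zero_iff (isQuadraticPseudoHessian_diag₁ a b)
      (isQuadraticPseudoHessian_diag₂ a' b')).2 (det_gram_diag₂ a' b') ![1, 1]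
    simp [det_gram_diag₁, ha, hb] at key
  · exact hscalar (isQuadraticPseudoHessian_diag₃ a') (hasDivergenceMatrix_diag₃ a')
  · exact hscalar (isQuadraticPseudoHessian_diag₄ r hc) (hasDivergenceMatrix_diag₄ r c)
  · exact hscalar (isQuadraticPseudoHessian_diag₅ p q hu) (hasDivergenceMatrix_diag₅ p q u)

/-- For `a' = a`, `b' = 0` the divergence matrices agree and both determinants vanish, so the
invariants do not suffice and the entries are compared. -/
theorem diag₂_not_affineIsomorphic_diag₁ {a b : ℝ} (ha : a ≠ 0) (hb : b ≠ 0) (a' b' : ℝ) :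
    ¬ (diag₂ a b).AffineIsomorphic (diag₁ a' b') := by
  intro hiso
  obtain ⟨P, hdet, hP⟩ := hiso.exists_gram_eq (isQuadraticPseudoHessian_diag₂ a b).2
    (isQuadraticPseudoHessian_diag₁ a' b').2
  rw [Matrix.det_fin_two] at hdet
  have key : ∀ (i j : Fin 2) (x y : ℝ), _ := fun i j x y =>
    congrFun (congrFun (hP ![x, y]) i) j
  simp only [diag₁, diag₂, gram_ofPlaneMatrix] at key
  have k₀₀ := key 0 0
  have k₀₁ := key 0 1
  have k₁₁ := key 1 1
  simp [Matrix.mul_apply, Matrix.mulVec, dotProduct, Fin.sum_univ_two] at k₀₀ k₀₁ k₁₁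
  -- The off-diagonal entry, zero in the target, is `P 0 0 * P 1 0 * (a x ^ 2 + b y ^ 2)` after
  -- transport.
  have hpr : P 0 0 = 0 ∨ P 1 0 = 0 := by
    have := k₀₁ 1 0
    simpa [ha] using this
  /- The form `a x² + b y²` is nondegenerate, hence not a multiple of the square of a linear form. -/
  have hcross : ∀ {e p q s : ℝ}, s ≠ 0 →
      (∀ x y : ℝ, e * (p * x + q * y) ^ 2 = s ^ 2 * (a * x ^ 2 + b * y ^ 2)) → False := by
    intro e p q s hs hk
    have h₁ := hk 1 0
    have h₂ := hk 0 1
    have h₃ := hk 1 1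
    have hsum : e * p * q = 0 := by linear_combination (h₃ - h₁ - h₂) / 2
    -- The product of the two square coefficients, `(e p ^ 2) (e q ^ 2)`, is the square of `e p q`,
    -- which is zero.
    have hprod : s ^ 4 * (a * b) = 0 := by
      linear_combination -h₁ * (s ^ 2 * b) - e * p ^ 2 * h₂ + e * p * q * hsum
    simp [hs, ha, hb] at hprod
  rcases hpr with hp | hr
  · rw [hp, zero_mul, zero_sub, neg_ne_zero] at hdet
    exact hcross (e := b') (p := P 1 0) (q := P 1 1) (right_ne_zero_of_mul hdet)
      fun x y => by linear_combination k₁₁ x y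
  · rw [hr, mul_zero, sub_zero] at hdet
    exact hcross (e := a') (p := P 0 0) (q := P 0 1) (left_ne_zero_of_mul hdet)
      fun x y => by linear_combination k₀₀ x y

theorem diag₂_not_affineIsomorphic {a b : ℝ} (ha : a ≠ 0) (hb : b ≠ 0) :
    (∀ a' b' : ℝ, ¬ (diag₂ a b).AffineIsomorphic (diag₁ a' b')) ∧
    (∀ a' : ℝ, ¬ (diag₂ a b).AffineIsomorphic (diag₃ a')) ∧
    (∀ r c : ℝ, c ≠ 0 → ¬ (diag₂ a b).AffineIsomorphic (diag₄ r c)) ∧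
    (∀ p q u : ℝ, u ≠ 0 → ¬ (diag₂ a b).AffineIsomorphic (diag₅ p q u)) := by
  have hscalar : ∀ {h' : BivectorField (Fin 2 → ℝ)} {k : ℝ}, h'.IsQuadraticPseudoHessian →
      h'.HasDivergenceMatrix (Matrix.diagonal fun _ => k) →
      ¬ (diag₂ a b).AffineIsomorphic h' := by
    intro h' k hh' hk hiso
    have key := hiso.eq_of_hasDivergenceMatrix_const_right (isQuadraticPseudoHessian_diag₂ a b) hh'
      (hasDivergenceMatrix_diag₂ a b) hk
    have h₀ : 2 * a = k := key 0
    have h₁ : 0 = k := key 1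
    exact ha (by linarith)
  refine ⟨diag₂_not_affineIsomorphic_diag₁ ha hb, fun a' => ?_, fun r c hc => ?_,
    fun p q u hu => ?_⟩
  · exact hscalar (isQuadraticPseudoHessian_diag₃ a') (hasDivergenceMatrix_diag₃ a')
  · exact hscalar (isQuadraticPseudoHessian_diag₄ r hc) (hasDivergenceMatrix_diag₄ r c)
  · exact hscalar (isQuadraticPseudoHessian_diag₅ p q hu) (hasDivergenceMatrix_diag₅ p q u)

/-- Here the determinant vanishes identically while the divergence is the scalar `3 a ≠ 0`. In each
other family a vanishing determinant forces the divergence to have eigenvalue zero. -/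
theorem diag₃_not_affineIsomorphic {a : ℝ} (ha : a ≠ 0) :
    (∀ a' b' : ℝ, ¬ (diag₃ a).AffineIsomorphic (diag₁ a' b')) ∧
    (∀ a' b' : ℝ, ¬ (diag₃ a).AffineIsomorphic (diag₂ a' b')) ∧
    (∀ r c : ℝ, c ≠ 0 → ¬ (diag₃ a).AffineIsomorphic (diag₄ r c)) ∧
    (∀ p q u : ℝ, u ≠ 0 → ¬ (diag₃ a).AffineIsomorphic (diag₅ p q u)) := by
  have hdet : ∀ {h' : BivectorField (Fin 2 → ℝ)}, h'.IsQuadraticPseudoHessian →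
      (diag₃ a).AffineIsomorphic h' → ∀ x, (gram h' x).det = 0 := fun hh' hiso =>
    (hiso.det_gram_eq_zero_iff (isQuadraticPseudoHessian_diag₃ a) hh').1 (det_gram_diag₃ a)
  have hdiv : ∀ {h' : BivectorField (Fin 2 → ℝ)} {d : Fin 2 → ℝ}, h'.IsQuadraticPseudoHessian →
      (diag₃ a).AffineIsomorphic h' → h'.HasDivergenceMatrix (Matrix.diagonal d) →
      ∀ i, d i = 3 * a := fun hh' hiso hd =>
    hiso.eq_of_hasDivergenceMatrix_const_left (isQuadraticPseudoHessian_diag₃ a) hh'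
      (hasDivergenceMatrix_diag₃ a) hd
  refine ⟨fun a' b' hiso => ?_, fun a' b' hiso => ?_, fun r c hc hiso => ?_,
    fun p q u hu hiso => ?_⟩
  · have hq := isQuadraticPseudoHessian_diag₁ a' b'
    have h₀ : 2 * a' = 3 * a := hdiv hq hiso (hasDivergenceMatrix_diag₁ a' b') 0
    have h₁ : 2 * b' = 3 * a := hdiv hq hiso (hasDivergenceMatrix_diag₁ a' b') 1
    have h₂ := hdet hq hiso ![1, 1]
    simp [det_gram_diag₁] at h₂
    rcases h₂ with h₂ | h₂ <;> exact ha (by linarith)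
  · have h₁ : 0 = 3 * a := hdiv (isQuadraticPseudoHessian_diag₂ a' b') hiso
      (hasDivergenceMatrix_diag₂ a' b') 1
    exact ha (by linarith)
  · have hq := isQuadraticPseudoHessian_diag₄ r hc
    have h₀ : 4 * r ^ 2 / c = 3 * a := hdiv hq hiso (hasDivergenceMatrix_diag₄ r c) 0
    have h₂ := hdet hq hiso ![0, 1]
    simp [det_gram_diag₄ r hc] at h₂
    rw [h₂] at h₀
    exact ha (by linarith [show 4 * (0 : ℝ) ^ 2 / c = 0 by simp])
  · have hq := isQuadraticPseudoHessian_diag₅ p q hu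
    have h₀ : 4 * p ^ 2 / u + 2 * q = 3 * a := hdiv hq hiso (hasDivergenceMatrix_diag₅ p q u) 0
    have h₂ := hdet hq hiso ![1, 0]
    simp [det_gram_diag₅ p q hu, hu] at h₂
    have h₃ : 4 * p ^ 2 / u + 2 * q = 2 * (2 * p ^ 2 + q * u) / u := by
      field_simp
      ring
    rw [h₃, h₂, mul_zero, zero_div] at h₀
    exact ha (by linarith)

/-- The determinant vanishes only at the origin here, whereas in the other four families it vanishes
at `(1, 0)`. -/
theorem diag₅_not_affineIsomorphic {p q u : ℝ} (hu : u ≠ 0) (hneg : 2 * p ^ 2 + q * u < 0) :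
    (∀ a b : ℝ, ¬ (diag₅ p q u).AffineIsomorphic (diag₁ a b)) ∧
    (∀ a b : ℝ, ¬ (diag₅ p q u).AffineIsomorphic (diag₂ a b)) ∧
    (∀ a : ℝ, ¬ (diag₅ p q u).AffineIsomorphic (diag₃ a)) ∧
    (∀ r c : ℝ, c ≠ 0 → ¬ (diag₅ p q u).AffineIsomorphic (diag₄ r c)) := by
  have hdet : ∀ {h' : BivectorField (Fin 2 → ℝ)}, h'.IsQuadraticPseudoHessian →
      (gram h' ![1, 0]).det = 0 → ¬ (diag₅ p q u).AffineIsomorphic h' := by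
    intro h' hh' hz hiso
    obtain ⟨x, hx, hx'⟩ := hiso.exists_det_gram_eq_zero (isQuadraticPseudoHessian_diag₅ p q hu)
      hh' ⟨![1, 0], fun h0 => one_ne_zero (congrFun h0 0), hz⟩
    exact det_gram_diag₅_ne_zero hu hneg hx hx'
  refine ⟨fun a b => ?_, fun a b => ?_, fun a => ?_, fun r c hc => ?_⟩
  · exact hdet (isQuadraticPseudoHessian_diag₁ a b) (by simp [det_gram_diag₁])
  · exact hdet (isQuadraticPseudoHessian_diag₂ a b) (det_gram_diag₂ a b _)
  · exact hdet (isQuadraticPseudoHessian_diag₃ a) (det_gram_diag₃ a _)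
  · exact hdet (isQuadraticPseudoHessian_diag₄ r hc) (by simp [det_gram_diag₄ r hc])

end NonIsomorphic

end BivectorField

end

/-! ### Assembly of the four cases. -/

theorem mainTheorem10 :
    -- the divergence is linear, and its conjugacy class is an affine invariant
    (∀ h : BivectorField (Fin 2 → ℝ), h.IsQuadraticPseudoHessian →
      ∃! L : Matrix (Fin 2) (Fin 2) ℝ, h.HasDivergenceMatrix L) ∧
    (∀ h h' : BivectorField (Fin 2 → ℝ), h.IsQuadraticPseudoHessian →
      h'.IsQuadraticPseudoHessian → h.AffineIsomorphic h' →
      ∀ L L' : Matrix (Fin 2) (Fin 2) ℝ, h.HasDivergenceMatrix L → h'.HasDivergenceMatrix L' →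
        IsConj L L') ∧
    -- (1) divergence free
    ((∀ u : ℝ, (free₁ u).IsQuadraticPseudoHessian ∧ (free₁ u).IsDivergenceFree) ∧
      (∀ r c : ℝ, c ≠ 0 →
        (free₂ r c).IsQuadraticPseudoHessian ∧ (free₂ r c).IsDivergenceFree) ∧
      (∀ h : BivectorField (Fin 2 → ℝ), h.IsQuadraticPseudoHessian → h.IsDivergenceFree →
        (∃ u : ℝ, h.AffineIsomorphic (free₁ u)) ∨
        (∃ r c : ℝ, c ≠ 0 ∧ h.AffineIsomorphic (free₂ r c))) ∧
      (∀ u u' : ℝ, (free₁ u).AffineIsomorphic (free₁ u') ↔ SignType.sign u = SignType.sign u') ∧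
      (∀ r c : ℝ, c ≠ 0 → (free₂ r c).AffineIsomorphic (free₁ c))) ∧
    -- (2) divergence similar to a Jordan block
    ((∀ c : ℝ, (jordan₁ c).IsQuadraticPseudoHessian ∧ (jordan₁ c).HasJordanDivergence 0) ∧
      (∀ c : ℝ, (jordan₂ c).IsQuadraticPseudoHessian ∧ (jordan₂ c).HasJordanDivergence 0) ∧
      (∀ (h : BivectorField (Fin 2 → ℝ)) (a : ℝ), h.IsQuadraticPseudoHessian →
        h.HasJordanDivergence a →
        (∃ c : ℝ, h.AffineIsomorphic (jordan₁ c)) ∨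
        (∃ c : ℝ, h.AffineIsomorphic (jordan₂ c))) ∧
      (∀ c c' : ℝ, ¬ (jordan₁ c).AffineIsomorphic (jordan₂ c'))) ∧
    -- (3) diagonalizable divergence
    ((∀ a b : ℝ,
        (diag₁ a b).IsQuadraticPseudoHessian ∧ (diag₁ a b).HasDiagonalizableDivergence) ∧
      (∀ a b : ℝ,
        (diag₂ a b).IsQuadraticPseudoHessian ∧ (diag₂ a b).HasDiagonalizableDivergence) ∧
      (∀ a : ℝ, (diag₃ a).IsQuadraticPseudoHessian ∧ (diag₃ a).HasDiagonalizableDivergence) ∧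
      (∀ r c : ℝ, c ≠ 0 →
        (diag₄ r c).IsQuadraticPseudoHessian ∧ (diag₄ r c).HasDiagonalizableDivergence) ∧
      (∀ p q u : ℝ, u ≠ 0 →
        (diag₅ p q u).IsQuadraticPseudoHessian ∧ (diag₅ p q u).HasDiagonalizableDivergence) ∧
      (∀ h : BivectorField (Fin 2 → ℝ), h.IsQuadraticPseudoHessian →
        h.HasDiagonalizableDivergence →
        (∃ a b : ℝ, h.AffineIsomorphic (diag₁ a b)) ∨
        (∃ a b : ℝ, h.AffineIsomorphic (diag₂ a b)) ∨
        (∃ a : ℝ, h.AffineIsomorphic (diag₃ a)) ∨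
        (∃ r c : ℝ, c ≠ 0 ∧ h.AffineIsomorphic (diag₄ r c)) ∨
        (∃ p q u : ℝ, u ≠ 0 ∧ h.AffineIsomorphic (diag₅ p q u))) ∧
      -- how far the five families are irredundant
      (∀ a b : ℝ, a ≠ 0 → b ≠ 0 → a ≠ b →
        (∀ a' b' : ℝ, ¬ (diag₁ a b).AffineIsomorphic (diag₂ a' b')) ∧
        (∀ a' : ℝ, ¬ (diag₁ a b).AffineIsomorphic (diag₃ a')) ∧
        (∀ r c : ℝ, c ≠ 0 → ¬ (diag₁ a b).AffineIsomorphic (diag₄ r c)) ∧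
        (∀ p q u : ℝ, u ≠ 0 → ¬ (diag₁ a b).AffineIsomorphic (diag₅ p q u))) ∧
      (∀ a b : ℝ, a ≠ 0 → b ≠ 0 →
        (∀ a' b' : ℝ, ¬ (diag₂ a b).AffineIsomorphic (diag₁ a' b')) ∧
        (∀ a' : ℝ, ¬ (diag₂ a b).AffineIsomorphic (diag₃ a')) ∧
        (∀ r c : ℝ, c ≠ 0 → ¬ (diag₂ a b).AffineIsomorphic (diag₄ r c)) ∧
        (∀ p q u : ℝ, u ≠ 0 → ¬ (diag₂ a b).AffineIsomorphic (diag₅ p q u))) ∧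
      (∀ a : ℝ, a ≠ 0 →
        (∀ a' b' : ℝ, ¬ (diag₃ a).AffineIsomorphic (diag₁ a' b')) ∧
        (∀ a' b' : ℝ, ¬ (diag₃ a).AffineIsomorphic (diag₂ a' b')) ∧
        (∀ r c : ℝ, c ≠ 0 → ¬ (diag₃ a).AffineIsomorphic (diag₄ r c)) ∧
        (∀ p q u : ℝ, u ≠ 0 → ¬ (diag₃ a).AffineIsomorphic (diag₅ p q u))) ∧
      (∀ p q u : ℝ, u ≠ 0 → 2 * p ^ 2 + q * u < 0 →
        (∀ a b : ℝ, ¬ (diag₅ p q u).AffineIsomorphic (diag₁ a b)) ∧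
        (∀ a b : ℝ, ¬ (diag₅ p q u).AffineIsomorphic (diag₂ a b)) ∧
        (∀ a : ℝ, ¬ (diag₅ p q u).AffineIsomorphic (diag₃ a)) ∧
        (∀ r c : ℝ, c ≠ 0 → ¬ (diag₅ p q u).AffineIsomorphic (diag₄ r c))) ∧
      (∀ r c : ℝ, r ≠ 0 → c ≠ 0 →
        (diag₄ r c).AffineIsomorphic (diag₁ (2 * r ^ 2 / c) (2 * r ^ 2 / c)))) ∧
    -- (4) non-real eigenvalues
    ((∀ p u : ℝ, p ≠ 0 →
        (nonReal p u).IsQuadraticPseudoHessian ∧ (nonReal p u).HasNonRealDivergence) ∧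
      (∀ h : BivectorField (Fin 2 → ℝ), h.IsQuadraticPseudoHessian → h.HasNonRealDivergence →
        ∃ p u : ℝ, p ≠ 0 ∧ h.AffineIsomorphic (nonReal p u))) := by
  refine ⟨?_, fun h h' hh hh' hiso L L' hL hL' => hL.isConj hL' hh hh' hiso, ⟨?_, ?_, ?_, ?_, ?_⟩,
    ⟨?_, ?_, ?_, jordan₁_not_affineIsomorphic_jordan₂⟩,
    ⟨?_, ?_, ?_, ?_, ?_, ?_, ?_, ?_, ?_, ?_, ?_⟩, ?_, ?_⟩
  · intro h hh
    obtain ⟨a₀, a₁, a₂, b₀, b₁, b₂, c₀, c₁, c₂, rfl, -⟩ := hh.exists_planeQuad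
    exact ⟨_, hasDivergenceMatrix_planeQuad, fun L hL => hL.unique hasDivergenceMatrix_planeQuad⟩
  · exact fun u => ⟨isQuadraticPseudoHessian_free₁ u, isDivergenceFree_free₁ u⟩
  · exact fun r c hc => ⟨isQuadraticPseudoHessian_free₂ r hc, isDivergenceFree_free₂ r c⟩
  · intro h hh hL
    rcases eq_free₁_or_eq_free₂ hh hL with ⟨u, rfl⟩ | ⟨r, c, hc, rfl⟩
    · exact Or.inl ⟨u, AffineIsomorphic.refl _⟩
    · exact Or.inr ⟨r, c, hc, AffineIsomorphic.refl _⟩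
  · exact free₁_affineIsomorphic_iff
  · exact fun r c hc => free₂_affineIsomorphic_free₁ r hc
  · exact fun c => ⟨isQuadraticPseudoHessian_jordan₁ c, _, hasDivergenceMatrix_jordan₁ c,
      IsConj.refl _⟩
  · exact fun c => ⟨isQuadraticPseudoHessian_jordan₂ c, _, hasDivergenceMatrix_jordan₂ c,
      IsConj.refl _⟩
  · rintro h a hh ⟨L, hL, hconj⟩
    obtain ⟨h', hh', hL', hiso⟩ := exists_affineIsomorphic_of_isConj hh hL hconj
    rcases eq_jordan₁_or_eq_jordan₂ hh' hL' with ⟨c, rfl⟩ | ⟨c, rfl⟩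
    · exact Or.inl ⟨c, hiso⟩
    · exact Or.inr ⟨c, hiso⟩
  · exact fun a b => ⟨isQuadraticPseudoHessian_diag₁ a b,
      hasDiagonalizableDivergence_of_diagonal (hasDivergenceMatrix_diag₁ a b)⟩
  · exact fun a b => ⟨isQuadraticPseudoHessian_diag₂ a b,
      hasDiagonalizableDivergence_of_diagonal (hasDivergenceMatrix_diag₂ a b)⟩
  · exact fun a => ⟨isQuadraticPseudoHessian_diag₃ a,
      hasDiagonalizableDivergence_of_diagonal (hasDivergenceMatrix_diag₃ a)⟩
  · exact fun r c hc => ⟨isQuadraticPseudoHessian_diag₄ r hc,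
      hasDiagonalizableDivergence_of_diagonal (hasDivergenceMatrix_diag₄ r c)⟩
  · exact fun p q u hu => ⟨isQuadraticPseudoHessian_diag₅ p q hu,
      hasDiagonalizableDivergence_of_diagonal (hasDivergenceMatrix_diag₅ p q u)⟩
  · rintro h hh ⟨L, hL, d, hconj⟩
    obtain ⟨h', hh', hL', hiso⟩ := exists_affineIsomorphic_of_isConj hh hL hconj
    rw [Matrix.eta_fin_two (Matrix.diagonal d)] at hL'
    simp only [Matrix.diagonal_apply_eq, ne_eq, zero_ne_one, one_ne_zero, not_false_eq_true,
      Matrix.diagonal_apply_ne] at hL'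
    rcases classification_of_diagonal hh' hL' with
      ⟨a, b, hf⟩ | ⟨a, b, hf⟩ | ⟨a, hf⟩ | ⟨p, q, u, hu, hf⟩
    · exact Or.inl ⟨a, b, hiso.trans hf⟩
    · exact Or.inr (Or.inl ⟨a, b, hiso.trans hf⟩)
    · exact Or.inr (Or.inr (Or.inl ⟨a, hiso.trans hf⟩))
    · exact Or.inr (Or.inr (Or.inr (Or.inr ⟨p, q, u, hu, hiso.trans hf⟩)))
  · exact fun a b ha hb hab => diag₁_not_affineIsomorphic ha hb hab
  · exact fun a b ha hb => diag₂_not_affineIsomorphic ha hb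
  · exact fun a ha => diag₃_not_affineIsomorphic ha
  · exact fun p q u hu hneg => diag₅_not_affineIsomorphic hu hneg
  · exact fun r c hr hc => diag₄_affineIsomorphic_diag₁ hr hc
  · exact fun p u hp => ⟨isQuadraticPseudoHessian_nonReal p u, hasNonRealDivergence_nonReal hp u⟩
  · rintro h hh ⟨L, hL, z, hz, him⟩
    obtain ⟨s, t, ht, hconj⟩ := exists_isConj_of_nonReal hz him
    obtain ⟨h', hh', hL', hiso⟩ := exists_affineIsomorphic_of_isConj hh hL hconj
    obtain ⟨p, u, hp, rfl⟩ := eq_nonReal hh' ht hL'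
    exact ⟨p, u, hp, hiso⟩
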